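/- Let $T>0$ and write $p^-=\max(-p,0)$. For $N\ge 1$ let $S_N=\{0,\tfrac1N,\dots,1\}$ and let $V^N:[0,T]\times S_N\to\mathbb R$ be the value function of the symmetric feedback Nash equilibrium of the game with $N+1$ players on $\{-1,1\}$, with running cost $a^2/2$ for flipping at rate $a$ and final cost $-mx$ ($x$ being the state of the player and $m$ the mean state of the other players); here $V^N(t,\mu)$ is the value at time $t$ for a player in state $1$ when the fraction $\mu$ of the other players is in state $1$. That is, $V^N$ is the solution of $$-\tfrac{d}{dt}V^N(t,\mu)+\tfrac12\big([V^N(t,1-\mu)-V^N(t,\mu)]^-\big)^2 = N\mu\,[V^N(t,1-\mu)-V^N(t,\mu)]^-\,[V^N(t,\mu-\tfrac1N)-V^N(t,\mu)]$$ $$\qquad+\,N(1-\mu)\,[V^N(t,\mu+\tfrac1N)-V^N(t,1-\mu-\tfrac1N)]^-\,[V^N(t,\mu+\tfrac1N)-V^N(t,\mu)],\qquad V^N(T,\mu)=-(2\mu-1),$$ where a term with coefficient $\mu=0$ or $1-\mu=0$ is zero. Let $\mathfrak g(m,z)=\tfrac12 m z|z|-\tfrac12 z^2$ and let $Z:[0,T]\times[-1,1]\to\mathbb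 R$ be the entropy solution of $$\partial_t Z+\partial_m\,\mathfrak g(m,Z)=0,\qquad Z(0,m)=2m,$$ with possible shock on $m=0$. That is, $Z$ is $C^1$ on $[0,T]\times([-1,1]\setminus\{0\})$ and solves the equation classically there, it takes the initial datum for every $m\in[-1,1]$, and for every $t\in[0,T]$ the limits $Z_\pm(t)=\lim_{m\to0^\pm}Z(t,m)$ exist and satisfy, if they differ, the Rankine–Hugoniot condition $0=\frac{\mathfrak g(0,Z_-)-\mathfrak g(0,Z_+)}{Z_--Z_+}$ and the Lax condition $\frac{\mathfrak g(0,c)-\mathfrak g(0,Z_+)}{c-Z_+}<0<\frac{\mathfrak g(0,c)-\mathfrak g(0,Z_-)}{c-Z_-}$ for every $c$ strictly between $Z_-(t)$ and $Z_+(t)$. Let $U:[0,T]\times\{-1,1\}\times[-1,1]\to\mathbb R$ be the solution of the master equation that corresponds to $Z$. That is, with $\Delta^xU(t,x,m)=U(t,-x,m)-U(t,x,m)$ and $D^mU(t,x,m,y)=\lim_{s\downarrow0}\frac{U(t,x,m-2ys)-U(t,x,m)}{s}$, the function $U(\cdot,x,\cdot)$ is $C^1$ on $[0,T]\times([-1,1]\setminus\{0\})$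 for $x=\pm1$ and satisfies there $$-\partial_tU(t,x,m)+\tfrac12\big([\Delta^xU(t,x,m)]^-\big)^2-D^mU(t,x,m,1)\,[\Delta^xU(t,1,m)]^-\,\tfrac{1+m}2-D^mU(t,x,m,-1)\,[\Delta^xU(t,-1,m)]^-\,\tfrac{1-m}2=0$$ (the terms with coefficient $\frac{1\pm m}{2}=0$ are zero), and for all $m\in[-1,1]$, $t\in[0,T]$ one has $U(T,x,m)=-mx$ and $U(t,-1,m)-U(t,1,m)=Z(T-t,m)$. Put $U^*(t,\mu)=U(t,1,2\mu-1)$. Such $Z$, $U$ exist, and $V^N$ exists for every $N\ge1$. There are constants $C_\varepsilon$, $\varepsilon>0$, that depend only on $\varepsilon$ and $T$, with $\lim_{\varepsilon\to0}C_\varepsilon=+\infty$, such that for all $\varepsilon>0$, $N\ge1$, $t\in[0,T]$ and $\mu\in S_N\setminus(\tfrac12-\varepsilon,\tfrac12+\varepsilon)$ $$|V^N(t,\mu)-U^*(t,\mu)|\le\frac{C_\varepsilon}{N}.$$ Moreover, if $T>\tfrac12$ (so that $U^*$ is discontinuous at $\mu=\frac12$), the blow-up cannot be avoided: every family of constants $C_\varepsilon$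 for which this estimate holds satisfies $\lim_{\varepsilon\to0}C_\varepsilon=+\infty$. -/

import Mathlib

open Set Filter Topology

namespace TwoStateMFG

noncomputable section

/-- `Z` is a piecewise `C¹` entropy solution on `[0,T] × [-1,1]` of the scalar conservation law
`∂ₜ Z + ∂ₘ (g (m, Z)) = 0`, `Z (0, m) = f m`, which is `C¹` off the curve `m = γ t`: it solves the
equation classically off the curve (one-sided derivatives at the boundary of the domain), takes the
initial datum, and its one-sided limits `Zm`, `Zp` at the curve satisfy, wherever they differ,
the Rankine-Hugoniot condition and the Lax (entropy) condition. -/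
structure IsEntropySolution (g : ℝ → ℝ → ℝ) (f : ℝ → ℝ) (T : ℝ) (γ : ℝ → ℝ)
    (Z : ℝ → ℝ → ℝ) : Prop where
  curve : ContDiffOn ℝ 1 γ (Icc 0 T)
  smooth : ContDiffOn ℝ 1 (fun p : ℝ × ℝ => Z p.1 p.2)
    {p | p.1 ∈ Icc 0 T ∧ p.2 ∈ Icc (-1) 1 ∧ p.2 ≠ γ p.1}
  equation : ∀ t ∈ Icc 0 T, ∀ m ∈ Icc (-1 : ℝ) 1, m ≠ γ t →
    derivWithin (fun s => Z s m) (Icc 0 T) t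
      + derivWithin (fun y => g y (Z t y)) (Icc (-1) 1) m = 0
  initial : ∀ m ∈ Icc (-1 : ℝ) 1, Z 0 m = f m
  shock : ∀ t ∈ Icc 0 T, ∃ Zm Zp : ℝ,
    Tendsto (Z t) (𝓝[<] (γ t)) (𝓝 Zm) ∧ Tendsto (Z t) (𝓝[>] (γ t)) (𝓝 Zp) ∧
    (Zm ≠ Zp →
      derivWithin γ (Icc 0 T) t = (g (γ t) Zm - g (γ t) Zp) / (Zm - Zp)) ∧
    ∀ c ∈ Ioo (min Zm Zp) (max Zm Zp),
      (g (γ t) c - g (γ t) Zp) / (c - Zp) < derivWithin γ (Icc 0 T) t ∧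
      derivWithin γ (Icc 0 T) t < (g (γ t) c - g (γ t) Zm) / (c - Zm)

/-- The flux of the conservation law of the two-state game. -/
def flux (m z : ℝ) : ℝ := m * (z * |z|) / 2 - z ^ 2 / 2

/-- The states `1` and `-1` are the elements of `ℤˣ`; this is the state as a real number. -/
def stateVal (x : ℤˣ) : ℝ := ((x : ℤ) : ℝ)

/-- The derivative `[D^m U (t, x, m, y)]_{-y}`, that is, the right derivative at `s = 0` of `U`
when the measure is replaced by itself plus `s (δ_{-y} - δ_y)`. A measure on `{-1, 1}` is identified
with its mean `m`, which this perturbation changes into `m - 2 y s`. -/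
def measureDeriv (U : ℝ → ℤˣ → ℝ → ℝ) (t : ℝ) (x : ℤˣ) (m : ℝ) (y : ℤˣ) : ℝ :=
  derivWithin (fun s => U t x (m - 2 * stateVal y * s)) (Ici 0) 0

/-- The increment `U (t, -x, m) - U (t, x, m)`. -/
def stateDiff (U : ℝ → ℤˣ → ℝ → ℝ) (t : ℝ) (x : ℤˣ) (m : ℝ) : ℝ := U t (-x) m - U t x m

/-- `U` is the solution of the master equation on `[0,T] × {-1,1} × [-1,1]`, with Hamiltonian
`(p⁻)² / 2`, running cost `F = 0` and final cost `G (x, m) = - m x`, which corresponds to `Z`: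
it is `C¹` and solves the equation classically off `m = 0`, and its increment
`U (t, -1, m) - U (t, 1, m)` is `Z (T - t, m)`. -/
structure IsMasterSolution (T : ℝ) (Z : ℝ → ℝ → ℝ) (U : ℝ → ℤˣ → ℝ → ℝ) : Prop where
  smooth : ∀ x, ContDiffOn ℝ 1 (fun p : ℝ × ℝ => U p.1 x p.2) (Icc 0 T ×ˢ (Icc (-1) 1 \ {0}))
  equation : ∀ t ∈ Icc 0 T, ∀ m ∈ Icc (-1 : ℝ) 1, m ≠ 0 → ∀ x,
    - derivWithin (fun s => U s x m) (Icc 0 T) t + (stateDiff U t x m)⁻ ^ 2 / 2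
      - measureDeriv U t x m 1 * (stateDiff U t 1 m)⁻ * ((1 + m) / 2)
      - measureDeriv U t x m (-1) * (stateDiff U t (-1) m)⁻ * ((1 - m) / 2) = 0
  terminal : ∀ m ∈ Icc (-1 : ℝ) 1, ∀ x, U T x m = - m * stateVal x
  increment : ∀ t ∈ Icc 0 T, ∀ m ∈ Icc (-1 : ℝ) 1, stateDiff U t 1 m = Z (T - t) m

/-- The grid `S_N = {0, 1/N, ..., 1}`. -/
def grid (N : ℕ) : Set ℝ := {μ | ∃ k : ℕ, k ≤ N ∧ μ = (k : ℝ) / N}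

/-- The Hamiltonian `H p = (p⁻)² / 2`. -/
def ham (p : ℝ) : ℝ := p⁻ ^ 2 / 2

/-- `V` is the value function `V^N (t, μ)`, on `[0,T] × S_N`, of the symmetric feedback Nash
equilibrium of the game with `N + 1` players, for a player in state `1` when the fraction `μ` of the
`N` other players is in state `1`: it solves the closed Hamilton-Jacobi-Bellman system. The values
of `V` off the grid appear only with the factor zero, at `μ = 0` and at `μ = 1`. -/
structure IsNashValue (T : ℝ) (N : ℕ) (V : ℝ → ℝ → ℝ) : Prop where
  diff : ∀ μ ∈ grid N, DifferentiableOn ℝ (fun s => V s μ) (Icc 0 T)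
  equation : ∀ t ∈ Icc 0 T, ∀ μ ∈ grid N,
    - derivWithin (fun s => V s μ) (Icc 0 T) t + ham (V t (1 - μ) - V t μ) =
      N * μ * (V t (1 - μ) - V t μ)⁻ * (V t (μ - 1 / N) - V t μ)
      + N * (1 - μ) * (V t (μ + 1 / N) - V t (1 - μ - 1 / N))⁻ * (V t (μ + 1 / N) - V t μ)
  terminal : ∀ μ ∈ grid N, V T μ = - (2 * μ - 1)

/-- The estimate `|V^N (t, μ) - U* (t, μ)| ≤ C ε / N`, where `U* (t, μ) = U (t, 1, 2 μ - 1)`, for all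
`ε > 0`, `N ≥ 1`, `t ∈ [0,T]` and all grid points `μ` at distance at least `ε` from `1/2`. -/
def ValueEstimate (T : ℝ) (U : ℝ → ℤˣ → ℝ → ℝ) (V : ℕ → ℝ → ℝ → ℝ) (C : ℝ → ℝ) : Prop :=
  ∀ ε > 0, ∀ N : ℕ, 1 ≤ N → ∀ t ∈ Icc 0 T,
    ∀ μ ∈ grid N \ Ioo (1 / 2 - ε) (1 / 2 + ε),
      |V N t μ - U t 1 (2 * μ - 1)| ≤ C ε / N

end

end TwoStateMFG

namespace TwoStateMFG

noncomputable section

/-! For `m > 0` and `z ≥ 0` the flux is `-(1 - m) z ^ 2 / 2`, so the characteristics solve `m' = -(1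
- m) z`, `z' = -z ^ 2 / 2`. Started at `m = x`, `z = 2 x` they are explicit: `z = 2 x / (1 + x t)`
and `1 - m = (1 - x) (1 + x t) ^ 2`. They move towards `m = 0`, so each point with `m > 0` lies on
exactly one of them that starts in `(0, 1]`, and this one has stayed in `m > 0` since time zero.
Hence `Z`, and then `U`, are determined off `m = 0`: a player in the majority never moves and has
the value minus the foot of the characteristic, and the value in the minority is obtained by adding
`Z`. The half `m < 0` follows by reflection. The flow map has slope at least `m + t x`
(`charPos_add_le`), which controls the foot as long as `m` stays away from `0`.

For the game with `N + 1` players a maximum principle shows that majority players never move either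
(`IsGridValue.increments_nonneg`). The equations at the indices `k` and `N - k`, with `k / N` beyond
the centre, then involve only `k`, `k + 1` and their mirror images. This is an upwind scheme in
which information travels inwards from `μ = 1`, so it can be compared with the limit on `k ≥ k₀`
without knowing anything about the centre. The characteristic solution satisfies the scheme up to
`O(1 / N)`, and a second maximum principle, for the errors, gives the estimate
(`IsGridValue.abs_sub_le`, `IsGridValue.abs_sub_cost_le`).

For `T > 1/2` and reversed times beyond `1/2` the jump of `Z` at `m = 0` is bounded below. For odd
`N` the equation at the grid point just below `1/2` has the extra term `-k z ^ 2`, of order `N`. If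
the constants did not tend to infinity, one bound `M / N` would hold at all grid points other than
`1/2`; then the remaining transport term is bounded, and the value decreases at a rate of order `N`
on a fixed time interval, although it lies in `[-1, 1]` (`IsGridValue.false_of_uniform_bound`). -/

/-! ### Characteristics on `m > 0` and their feet. -/

/-- The position at time `t` of the characteristic of the conservation law that starts at `x ≥ 0`. -/
def charPos (t x : ℝ) : ℝ := 1 - (1 - x) * (1 + x * t) ^ 2

/-- The derivative of `charPos t` at `x`. -/
def charSlope (t x : ℝ) : ℝ := (1 + x * t) * (1 - 2 * t + 3 * t * x)

lemma hasDerivAt_charPos (t x : ℝ) : HasDerivAt (charPos t) (charSlope t x) x := by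
  have h1 : HasDerivAt (fun x : ℝ => 1 + x * t) t x := by
    simpa using ((hasDerivAt_id x).mul_const t).const_add 1
  have h2 : HasDerivAt (fun x : ℝ => 1 - x) (-1) x := (hasDerivAt_id x).const_sub 1
  have h := (h2.mul (h1.pow 2)).const_sub 1
  refine h.congr_deriv ?_
  simp [charSlope]
  ring

lemma hasDerivAt_charPos_time (t x : ℝ) :
    HasDerivAt (fun s => charPos s x) (-(2 * x * (1 - x) * (1 + x * t))) t := by
  have h1 : HasDerivAt (fun s : ℝ => 1 + x * s) x t := by
    simpa using ((hasDerivAt_id t).const_mul x).const_add 1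
  have h := ((h1.pow 2).const_mul (1 - x)).const_sub 1
  refine h.congr_deriv ?_
  simp
  ring

lemma charPos_zero_right (t : ℝ) : charPos t 0 = 0 := by simp [charPos]

lemma charPos_one_right (t : ℝ) : charPos t 1 = 1 := by simp [charPos]

lemma charPos_zero_left (x : ℝ) : charPos 0 x = x := by simp [charPos]

lemma charPos_le_one {t x : ℝ} (hx : x ≤ 1) : charPos t x ≤ 1 := by
  have : 0 ≤ (1 - x) * (1 + x * t) ^ 2 := mul_nonneg (by linarith) (sq_nonneg _)
  unfold charPos; linarith

lemma charPos_anti {s t x : ℝ} (hs : 0 ≤ s) (hst : s ≤ t) (hx0 : 0 ≤ x) (hx : x ≤ 1) :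
    charPos t x ≤ charPos s x := by
  unfold charPos
  have h1 : 1 + x * s ≤ 1 + x * t := by gcongr
  have h2 : (1 + x * s) ^ 2 ≤ (1 + x * t) ^ 2 := by gcongr
  have := mul_le_mul_of_nonneg_left h2 (sub_nonneg.2 hx)
  linarith

/-- Here `charPos t x = x q` with `q` quadratic in `x`. Positivity of the position forces `q > 0`,
whence `x q ≤ q`, and the right-hand side exceeds `q + t x` by exactly `t ^ 2 x (1 - x)`. The
right-hand side is the nontrivial factor of `charSlope`: characteristics still in `m > 0` have not
yet focused. -/
lemma charPos_add_le {t x : ℝ} (hx0 : 0 < x) (hx : x ≤ 1) (h : 0 < charPos t x) :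
    charPos t x + t * x ≤ 1 - 2 * t + 3 * t * x := by
  have e : charPos t x = x * (1 - 2 * t + x * (2 * t - t ^ 2) + x ^ 2 * t ^ 2) := by
    unfold charPos; ring
  set q := 1 - 2 * t + x * (2 * t - t ^ 2) + x ^ 2 * t ^ 2 with hq
  have hq0 : 0 < q := by
    rw [e] at h
    exact (pos_iff_pos_of_mul_pos h).1 hx0
  have h1 : x * q ≤ q := by nlinarith
  have h2 : 0 ≤ t ^ 2 * (x * (1 - x)) := by
    have : 0 ≤ 1 - x := by linarith
    positivity
  rw [e]
  nlinarith

lemma le_charSlope {t x : ℝ} (ht : 0 ≤ t) (hx0 : 0 < x) (hx : x ≤ 1) (h : 0 < charPos t x) :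
    1 - 2 * t + 3 * t * x ≤ charSlope t x := by
  have h1 := charPos_add_le hx0 hx h
  have h2 : 0 ≤ x * t := by positivity
  unfold charSlope
  nlinarith

/-- The factor `1 - 2 t + 3 t w` of the slope increases with `w`, so the lower bound at the left end
`x` holds on all of `[x, y]`, and the mean value inequality applies. -/
lemma charPos_sub_ge {t x y : ℝ} (ht : 0 ≤ t) (hx0 : 0 < x) (hxy : x ≤ y) (hy : y ≤ 1)
    (h : 0 < charPos t x) :
    (charPos t x + t * x) * (y - x) ≤ charPos t y - charPos t x := by
  have h1 := charPos_add_le hx0 (hxy.trans hy) h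
  have key : ∀ w ∈ interior (Icc x y), charPos t x + t * x ≤ deriv (charPos t) w := by
    intro w hw
    rw [interior_Icc] at hw
    rw [(hasDerivAt_charPos t w).deriv]
    have h2 : 1 - 2 * t + 3 * t * x ≤ 1 - 2 * t + 3 * t * w := by
      have := mul_le_mul_of_nonneg_left hw.1.le ht
      linarith
    have h3 : 0 ≤ t * x := by positivity
    have h4 : 0 ≤ w * t := mul_nonneg (hx0.trans hw.1).le ht
    unfold charSlope
    nlinarith
  have hd : Differentiable ℝ (charPos t) := fun w => (hasDerivAt_charPos t w).differentiableAt
  exact Convex.mul_sub_le_image_sub_of_le_deriv (convex_Icc x y) hd.continuous.continuousOn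
    hd.differentiableOn key x (left_mem_Icc.2 hxy) y (right_mem_Icc.2 hxy) hxy

lemma charPos_lt {t x y : ℝ} (ht : 0 ≤ t) (hx0 : 0 < x) (hxy : x < y) (hy : y ≤ 1)
    (h : 0 < charPos t x) : charPos t x < charPos t y := by
  have h1 := charPos_sub_ge ht hx0 hxy.le hy h
  have h2 : 0 < (charPos t x + t * x) * (y - x) := by
    have : 0 < y - x := by linarith
    positivity
  linarith

lemma charPos_taylor {t T x y : ℝ} (ht : 0 ≤ t) (htT : t ≤ T) (hx0 : 0 ≤ x) (hx : x ≤ 1)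
    (hy0 : 0 ≤ y) (hy : y ≤ 1) :
    |charPos t y - charPos t x - charSlope t x * (y - x)| ≤ (2 * T + 2 * T ^ 2) * (y - x) ^ 2 := by
  have e : charPos t y - charPos t x - charSlope t x * (y - x)
      = (2 * t + t ^ 2 * (2 * x + y - 1)) * (y - x) ^ 2 := by
    unfold charPos charSlope; ring
  rw [e, abs_mul, abs_of_nonneg (sq_nonneg (y - x))]
  refine mul_le_mul_of_nonneg_right ?_ (sq_nonneg _)
  have h2 : t ^ 2 ≤ T ^ 2 := by gcongr
  have h3 : 0 ≤ t ^ 2 := sq_nonneg t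
  rw [abs_le]
  constructor <;> nlinarith

lemma exists_charPos_eq {t m : ℝ} (hm : m ∈ Ioc (0 : ℝ) 1) : ∃ x ∈ Ioc (0 : ℝ) 1, charPos t x = m := by
  have hc : ContinuousOn (charPos t) (Icc 0 1) :=
    (continuous_iff_continuousAt.2 fun w => (hasDerivAt_charPos t w).continuousAt).continuousOn
  obtain ⟨x, hx, h⟩ := intermediate_value_Icc zero_le_one hc
    (show m ∈ Icc (charPos t 0) (charPos t 1) by
      rw [charPos_zero_right, charPos_one_right]; exact ⟨hm.1.le, hm.2⟩)
  refine ⟨x, ⟨lt_of_le_of_ne hx.1 ?_, hx.2⟩, h⟩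
  rintro rfl
  rw [charPos_zero_right] at h
  exact hm.1.ne h

open Classical in
/-- The starting point of the characteristic that is at `m > 0` at time `t`. -/
def charFoot (t m : ℝ) : ℝ :=
  if h : ∃ x ∈ Ioc (0 : ℝ) 1, charPos t x = m then h.choose else 0

lemma charFoot_mem {t m : ℝ} (hm : m ∈ Ioc (0 : ℝ) 1) : charFoot t m ∈ Ioc (0 : ℝ) 1 := by
  have h := exists_charPos_eq (t := t) hm
  rw [charFoot, dif_pos h]
  exact h.choose_spec.1

lemma charPos_charFoot {t m : ℝ} (hm : m ∈ Ioc (0 : ℝ) 1) : charPos t (charFoot t m) = m := by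
  have h := exists_charPos_eq (t := t) hm
  rw [charFoot, dif_pos h]
  exact h.choose_spec.2

lemma charFoot_eq {t m x : ℝ} (ht : 0 ≤ t) (hm : m ∈ Ioc (0 : ℝ) 1) (hx : x ∈ Ioc (0 : ℝ) 1)
    (h : charPos t x = m) : charFoot t m = x := by
  have h1 := charFoot_mem (t := t) hm
  have h2 := charPos_charFoot (t := t) hm
  rcases lt_trichotomy (charFoot t m) x with h3 | h3 | h3
  · have := charPos_lt ht h1.1 h3 hx.2 (h2.symm ▸ hm.1)
    linarith
  · exact h3
  · have := charPos_lt ht hx.1 h3 h1.2 (h.symm ▸ hm.1)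
    linarith

lemma charFoot_zero_left {m : ℝ} (hm : m ∈ Ioc (0 : ℝ) 1) : charFoot 0 m = m :=
  charFoot_eq le_rfl hm hm (charPos_zero_left m)

lemma charFoot_mono {t m n : ℝ} (ht : 0 ≤ t) (hm : m ∈ Ioc (0 : ℝ) 1) (hn : n ∈ Ioc (0 : ℝ) 1)
    (hmn : m ≤ n) : charFoot t m ≤ charFoot t n := by
  by_contra! h
  have := charPos_lt ht (charFoot_mem (t := t) hn).1 h (charFoot_mem hm).2
    (by rw [charPos_charFoot hn]; exact hn.1)
  rw [charPos_charFoot hm, charPos_charFoot hn] at this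
  linarith

/-- This gives the Lipschitz constant `1 / δ` on `m ≥ δ`. When `t` and the foot are bounded below,
the summand `t * charFoot t m` keeps the constant finite up to `m = 0`; the blow-up argument uses
this. -/
lemma charFoot_lipschitz {t m n : ℝ} (ht : 0 ≤ t) (hm : m ∈ Ioc (0 : ℝ) 1)
    (hn : n ∈ Ioc (0 : ℝ) 1) (hmn : m ≤ n) :
    (m + t * charFoot t m) * (charFoot t n - charFoot t m) ≤ n - m := by
  have := charPos_sub_ge ht (charFoot_mem (t := t) hm).1 (charFoot_mono ht hm hn hmn)
    (charFoot_mem hn).2 (by rw [charPos_charFoot hm]; exact hm.1)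
  rwa [charPos_charFoot hm, charPos_charFoot hn] at this

lemma le_charSlope_charFoot {t m : ℝ} (ht : 0 ≤ t) (hm : m ∈ Ioc (0 : ℝ) 1) :
    m ≤ charSlope t (charFoot t m) := by
  have hf := charFoot_mem (t := t) hm
  have h0 : 0 < charPos t (charFoot t m) := by rw [charPos_charFoot hm]; exact hm.1
  have h1 := charPos_add_le hf.1 hf.2 h0
  have h2 := le_charSlope ht hf.1 hf.2 h0
  rw [charPos_charFoot hm] at h1
  have : 0 ≤ t * charFoot t m := mul_nonneg ht hf.1.le
  linarith

/-- The value of the entropy solution at time `t` on the characteristic that starts at `x ≥ 0`. -/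
def charVal (t x : ℝ) : ℝ := 2 * x / (1 + x * t)

/-- The value `U (T - t, -1, ·)` on the characteristic that starts at `x ≥ 0`. -/
def charCost (t x : ℝ) : ℝ := -x + charVal t x

lemma charVal_nonneg {t x : ℝ} (ht : 0 ≤ t) (hx : 0 ≤ x) : 0 ≤ charVal t x := by
  unfold charVal; positivity

lemma charVal_le {t x : ℝ} (ht : 0 ≤ t) (hx : 0 ≤ x) : charVal t x ≤ 2 * x := by
  unfold charVal
  exact div_le_self (by positivity) (by nlinarith [mul_nonneg hx ht])

lemma charVal_sub {t x y : ℝ} (ht : 0 ≤ t) (hx : 0 ≤ x) (hy : 0 ≤ y) :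
    charVal t y - charVal t x = 2 * (y - x) / ((1 + y * t) * (1 + x * t)) := by
  have h1 : 0 < 1 + x * t := by positivity
  have h2 : 0 < 1 + y * t := by positivity
  unfold charVal
  field_simp
  ring

lemma charVal_lipschitz {t x y : ℝ} (ht : 0 ≤ t) (hx : 0 ≤ x) (hxy : x ≤ y) :
    0 ≤ charVal t y - charVal t x ∧ charVal t y - charVal t x ≤ 2 * (y - x) := by
  have hy := hx.trans hxy
  have h3 : 0 ≤ y - x := by linarith
  rw [charVal_sub ht hx hy]
  refine ⟨by positivity, div_le_self (by positivity) ?_⟩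
  have h1 : 1 ≤ 1 + x * t := by nlinarith [mul_nonneg hx ht]
  have h2 : 1 ≤ 1 + y * t := by nlinarith [mul_nonneg hy ht]
  nlinarith

/-- The cost is `-x` plus a function whose slope lies in `[0, 2]`. -/
lemma abs_charCost_sub_le {t x y : ℝ} (ht : 0 ≤ t) (hx : 0 ≤ x) (hxy : x ≤ y) :
    |charCost t y - charCost t x| ≤ y - x := by
  have := charVal_lipschitz ht hx hxy
  unfold charCost
  rw [abs_le]
  constructor <;> linarith [this.1, this.2]

lemma charCost_taylor {t T x y : ℝ} (ht : 0 ≤ t) (htT : t ≤ T) (hx : 0 ≤ x) (hy : 0 ≤ y) :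
    |charCost t y - charCost t x - (-1 + 2 / (1 + x * t) ^ 2) * (y - x)| ≤ 2 * T * (y - x) ^ 2 := by
  have h1 : 1 ≤ 1 + x * t := by nlinarith [mul_nonneg hx ht]
  have h2 : 1 ≤ 1 + y * t := by nlinarith [mul_nonneg hy ht]
  have e : charCost t y - charCost t x - (-1 + 2 / (1 + x * t) ^ 2) * (y - x)
      = -(2 * t * (y - x) ^ 2 / ((1 + y * t) * (1 + x * t) ^ 2)) := by
    have h : charCost t y - charCost t x = -(y - x) + (charVal t y - charVal t x) := by
      unfold charCost; ring
    rw [h, charVal_sub ht hx hy]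
    have h3 : 1 + x * t ≠ 0 := by positivity
    have h4 : 1 + y * t ≠ 0 := by positivity
    field_simp
    ring
  rw [e, abs_neg, abs_of_nonneg (by positivity)]
  calc _ ≤ 2 * t * (y - x) ^ 2 := by
        refine div_le_self (by positivity) ?_
        have : 1 ≤ (1 + x * t) ^ 2 := one_le_pow₀ h1
        nlinarith
    _ ≤ _ := by gcongr

lemma abs_charCost_le {t x : ℝ} (ht : 0 ≤ t) (hx : x ∈ Icc (0 : ℝ) 1) : |charCost t x| ≤ 1 := by
  have h1 := charVal_le ht hx.1
  have h2 := charVal_nonneg ht hx.1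
  unfold charCost
  rw [abs_le]
  constructor <;> linarith [hx.1, hx.2]

/-! ### Maximum principles for finite systems. -/

/-- The maximum principle for finitely many differential inequalities. -/
lemma nonpos_of_deriv_le_mul_of_isMax {ι : Type*} {S : Finset ι} {w w' : ι → ℝ → ℝ} {T L : ℝ}
    (hw : ∀ i ∈ S, ∀ t ∈ Icc 0 T, HasDerivWithinAt (w i) (w' i t) (Icc 0 T) t)
    (h0 : ∀ i ∈ S, w i 0 ≤ 0)
    (h : ∀ i ∈ S, ∀ t ∈ Icc 0 T, (∀ j ∈ S, w j t ≤ w i t) → 0 < w i t → w' i t ≤ L * w i t) :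
    ∀ i ∈ S, ∀ t ∈ Icc 0 T, w i t ≤ 0 := by
  intro i₀ hi₀ t₀ ht₀
  by_contra! hpos
  -- With this weight the derivative at a positive maximum over all indices and times is at most
  -- `-w` times the weight, hence strictly negative.
  set y : ι → ℝ → ℝ := fun i t => Real.exp (-(L + 1) * t) * w i t with hy
  have hE : ∀ t, HasDerivAt (fun t : ℝ => Real.exp (-(L + 1) * t))
      (Real.exp (-(L + 1) * t) * (-(L + 1))) t := fun t => by
    simpa using ((hasDerivAt_id t).const_mul (-(L + 1))).exp
  have hyd : ∀ i ∈ S, ∀ t ∈ Icc 0 T, HasDerivWithinAt (y i)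
      (Real.exp (-(L + 1) * t) * (-(L + 1)) * w i t + Real.exp (-(L + 1) * t) * w' i t)
      (Icc 0 T) t := fun i hi t ht => (hE t).hasDerivWithinAt.mul (hw i hi t ht)
  have hmax : ∀ i ∈ S, ∃ t ∈ Icc 0 T, IsMaxOn (y i) (Icc 0 T) t := fun i hi =>
    isCompact_Icc.exists_isMaxOn ⟨t₀, ht₀⟩ fun t ht => (hyd i hi t ht).continuousWithinAt
  choose! τ hτ hτm using hmax
  obtain ⟨i, hi, him⟩ := S.exists_max_image (fun i => y i (τ i)) ⟨i₀, hi₀⟩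
  have hall : ∀ j ∈ S, ∀ t ∈ Icc 0 T, y j t ≤ y i (τ i) := fun j hj t ht =>
    (hτm j hj ht).trans (him j hj)
  have hepos := Real.exp_pos (-(L + 1) * τ i)
  have hwpos : 0 < w i (τ i) := by
    have h1 : 0 < y i (τ i) :=
      lt_of_lt_of_le (mul_pos (Real.exp_pos _) hpos) (hall i₀ hi₀ t₀ ht₀)
    exact pos_of_mul_pos_right h1 hepos.le
  have hargmax : ∀ j ∈ S, w j (τ i) ≤ w i (τ i) := fun j hj =>
    le_of_mul_le_mul_left (hall j hj _ (hτ i hi)) hepos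
  have hd := h i hi _ (hτ i hi) hargmax hwpos
  have hτ0 : 0 < τ i := by
    rcases (hτ i hi).1.eq_or_lt with h1 | h1
    · have := h0 i hi
      rw [h1] at this
      linarith
    · exact h1
  -- The direction back to time zero is tangent to the interval even when the maximum is at `T`, so
  -- there the derivative is nonnegative.
  have hcone : (0 : ℝ) - τ i ∈ posTangentConeAt (Icc 0 T) (τ i) := by
    refine sub_mem_posTangentConeAt_of_segment_subset ?_
    rw [segment_symm, segment_eq_Icc hτ0.le]
    exact Icc_subset_Icc le_rfl (hτ i hi).2
  have hslope := (hτm i hi).localize.hasFDerivWithinAt_nonpos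
    (hyd i hi _ (hτ i hi)).hasFDerivWithinAt hcone
  simp only [ContinuousLinearMap.toSpanSingleton_apply, smul_eq_mul] at hslope
  have h1 : Real.exp (-(L + 1) * τ i) * (-(L + 1)) * w i (τ i)
      + Real.exp (-(L + 1) * τ i) * w' i (τ i) < 0 := by
    have : w' i (τ i) - (L + 1) * w i (τ i) < 0 := by linarith
    nlinarith
  nlinarith

/-- The maximum principle with a source term. -/
lemma le_mul_exp_of_deriv_le_of_isMax {ι : Type*} {S : Finset ι} {w w' : ι → ℝ → ℝ} {T L a : ℝ}
    (hL : 0 ≤ L) (ha : 0 ≤ a)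
    (hw : ∀ i ∈ S, ∀ t ∈ Icc 0 T, HasDerivWithinAt (w i) (w' i t) (Icc 0 T) t)
    (h0 : ∀ i ∈ S, w i 0 ≤ 0)
    (h : ∀ i ∈ S, ∀ t ∈ Icc 0 T, (∀ j ∈ S, w j t ≤ w i t) → 0 < w i t →
      w' i t ≤ L * w i t + a) :
    ∀ i ∈ S, ∀ t ∈ Icc 0 T, w i t ≤ a * Real.exp ((L + 1) * T) := by
  have hE : ∀ t, HasDerivAt (fun t : ℝ => a * Real.exp ((L + 1) * t))
      (a * (Real.exp ((L + 1) * t) * (L + 1))) t := fun t => by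
    simpa using (((hasDerivAt_id t).const_mul (L + 1)).exp).const_mul a
  have key := nonpos_of_deriv_le_mul_of_isMax (S := S)
    (w := fun i t => w i t - a * Real.exp ((L + 1) * t))
    (w' := fun i t => w' i t - a * (Real.exp ((L + 1) * t) * (L + 1))) (T := T) (L := L)
    (fun i hi t ht => (hw i hi t ht).sub (hE t).hasDerivWithinAt)
    (fun i hi => by
      have := h0 i hi
      simp only [mul_zero, Real.exp_zero, mul_one]
      linarith)
    (fun i hi t ht hm hp => by
      have h1 : 0 ≤ a * Real.exp ((L + 1) * t) := by positivity
      have h2 := h i hi t ht (fun j hj => by simpa using hm j hj) (by linarith)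
      have h3 : 1 ≤ Real.exp ((L + 1) * t) := by
        have : 0 ≤ (L + 1) * t := mul_nonneg (by linarith) ht.1
        exact Real.one_le_exp this
      have h4 : a * 1 ≤ a * Real.exp ((L + 1) * t) := by gcongr
      linarith)
  intro i hi t ht
  have h1 := key i hi t ht
  have h2 : a * Real.exp ((L + 1) * t) ≤ a * Real.exp ((L + 1) * T) := by
    gcongr
    exact ht.2
  linarith

/-! ### The grid system in reversed time: bounds and signs. -/

/-- The right-hand side of the closed system at the grid point `k / N`, in reversed time. -/
def gridField (N : ℕ) (x : ℕ → ℝ) (k : ℕ) : ℝ :=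
  -ham (x (N - k) - x k) + k * (x (N - k) - x k)⁻ * (x (k - 1) - x k)
    + ((N - k : ℕ) : ℝ) * (x (k + 1) - x (N - (k + 1)))⁻ * (x (k + 1) - x k)

/-- `v k s` is the value `V (T - s) (k / N)` of the game with `N + 1` players. -/
structure IsGridValue (T : ℝ) (N : ℕ) (v : ℕ → ℝ → ℝ) : Prop where
  initial : ∀ k ≤ N, v k 0 = 1 - 2 * k / N
  deriv : ∀ k ≤ N, ∀ s ∈ Icc 0 T,
    HasDerivWithinAt (v k) (gridField N (fun j => v j s) k) (Icc 0 T) s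

lemma initial_mem {N k : ℕ} (hk : k ≤ N) : -1 ≤ 1 - 2 * (k : ℝ) / N ∧ 1 - 2 * (k : ℝ) / N ≤ 1 := by
  have h1 : 0 ≤ (k : ℝ) / N := by positivity
  have h2 : (k : ℝ) / N ≤ 1 := div_le_one_of_le₀ (by exact_mod_cast hk) (by positivity)
  rw [mul_div_assoc]
  constructor <;> linarith

/-- At a largest component each transport term is a nonnegative rate times a nonpositive difference.
At a smallest one, in `gridField_nonneg`, the player has in addition no incentive to move, so the
Hamiltonian vanishes. For this only the order of the components matters, so a monotone cut-off of
them is harmless. -/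
lemma gridField_nonpos {N : ℕ} {x : ℕ → ℝ} {k : ℕ} (hk : k ≤ N) (h : ∀ j ≤ N, x j ≤ x k) :
    gridField N x k ≤ 0 := by
  have h1 : 0 ≤ ham (x (N - k) - x k) := by unfold ham; positivity
  have h2 : k * (x (N - k) - x k)⁻ * (x (k - 1) - x k) ≤ 0 :=
    mul_nonpos_of_nonneg_of_nonpos (mul_nonneg (by positivity) (negPart_nonneg _))
      (by linarith [h (k - 1) (by omega)])
  have h3 : ((N - k : ℕ) : ℝ) * (x (k + 1) - x (N - (k + 1)))⁻ * (x (k + 1) - x k) ≤ 0 := by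
    rcases hk.eq_or_lt with rfl | hk
    · simp
    · exact mul_nonpos_of_nonneg_of_nonpos (mul_nonneg (by positivity) (negPart_nonneg _))
        (by linarith [h (k + 1) (by omega)])
  unfold gridField
  linarith

lemma gridField_nonneg {N : ℕ} {x : ℕ → ℝ} {k : ℕ} (hk : k ≤ N) (h : ∀ j ≤ N, x k ≤ x j) :
    0 ≤ gridField N x k := by
  have h0 : (x (N - k) - x k)⁻ = 0 := negPart_eq_zero.2 (by linarith [h (N - k) (by omega)])
  have h3 : 0 ≤ ((N - k : ℕ) : ℝ) * (x (k + 1) - x (N - (k + 1)))⁻ * (x (k + 1) - x k) := by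
    rcases hk.eq_or_lt with rfl | hk
    · simp
    · exact mul_nonneg (mul_nonneg (by positivity) (negPart_nonneg _))
        (by linarith [h (k + 1) (by omega)])
  unfold gridField ham
  rw [h0]
  linarith

/-- Solutions of the system with arguments cut off by a monotone function stay in `[-1, 1]`. -/
lemma abs_le_one_of_monotone {T : ℝ} {N : ℕ} {v : ℕ → ℝ → ℝ} {c : ℝ → ℝ} (hc : Monotone c)
    (h0 : ∀ k ≤ N, v k 0 = 1 - 2 * k / N)
    (hv : ∀ k ≤ N, ∀ s ∈ Icc 0 T,
      HasDerivWithinAt (v k) (gridField N (fun j => c (v j s)) k) (Icc 0 T) s) :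
    ∀ k ≤ N, ∀ s ∈ Icc 0 T, |v k s| ≤ 1 := by
  have hu := nonpos_of_deriv_le_mul_of_isMax (S := Finset.range (N + 1))
    (w := fun k s => v k s - 1) (w' := fun k s => gridField N (fun j => c (v j s)) k)
    (T := T) (L := 0)
    (fun k hk s hs => (hv k (Finset.mem_range_succ_iff.1 hk) s hs).sub_const 1)
    (fun k hk => by
      have hk := Finset.mem_range_succ_iff.1 hk
      rw [h0 k hk]
      linarith [(initial_mem hk).2])
    (fun k hk s hs hm hp => by
      rw [zero_mul]
      refine gridField_nonpos (Finset.mem_range_succ_iff.1 hk) fun j hj => hc ?_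
      have := hm j (Finset.mem_range_succ_iff.2 hj)
      linarith)
  have hl := nonpos_of_deriv_le_mul_of_isMax (S := Finset.range (N + 1))
    (w := fun k s => -1 - v k s) (w' := fun k s => -gridField N (fun j => c (v j s)) k)
    (T := T) (L := 0)
    (fun k hk s hs => (hv k (Finset.mem_range_succ_iff.1 hk) s hs).const_sub (-1))
    (fun k hk => by
      have hk := Finset.mem_range_succ_iff.1 hk
      rw [h0 k hk]
      linarith [(initial_mem hk).1])
    (fun k hk s hs hm hp => by
      rw [zero_mul]
      refine neg_nonpos.2 (gridField_nonneg (Finset.mem_range_succ_iff.1 hk) fun j hj => hc ?_)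
      have := hm j (Finset.mem_range_succ_iff.2 hj)
      linarith)
  intro k hk s hs
  have h1 := hu k (Finset.mem_range_succ_iff.2 hk) s hs
  have h2 := hl k (Finset.mem_range_succ_iff.2 hk) s hs
  rw [abs_le]
  constructor <;> linarith

lemma IsGridValue.abs_le_one {T : ℝ} {N : ℕ} {v : ℕ → ℝ → ℝ} (hv : IsGridValue T N v) :
    ∀ k ≤ N, ∀ s ∈ Icc 0 T, |v k s| ≤ 1 :=
  abs_le_one_of_monotone monotone_id hv.initial hv.deriv

lemma negPart_le_of_neg_le {p η : ℝ} (hη : 0 ≤ η) (h : -p ≤ η) : p⁻ ≤ η := by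
  rw [negPart_def]
  exact sup_le h hη

lemma negPart_neg_of_nonneg {p : ℝ} (h : 0 ≤ p) : (-p)⁻ = p := by
  rw [negPart_def, neg_neg]
  exact sup_eq_left.2 h

/-- The contribution of the players in state `-1` to `gridField`. -/
def upField (N : ℕ) (x : ℕ → ℝ) (k : ℕ) : ℝ :=
  ((N - k : ℕ) : ℝ) * (x (k + 1) - x (N - (k + 1)))⁻ * (x (k + 1) - x k)

/-- The Hamiltonian and the transport by players in state `1` both contain the incentive to leave
state `1`, which is at most `η`. With values in `[-1, 1]` they are at most `η` and `2 N η`. -/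
lemma abs_gridField_sub_upField_le {N : ℕ} {x : ℕ → ℝ} {η : ℝ} (hη : 0 ≤ η)
    (hb : ∀ j ≤ N, |x j| ≤ 1) {k : ℕ} (hk : k ≤ N) (hZ : x k - x (N - k) ≤ η) :
    |gridField N x k - upField N x k| ≤ (2 * N + 1) * η := by
  have e : gridField N x k - upField N x k
      = -((x (N - k) - x k)⁻ ^ 2 / 2) + k * (x (N - k) - x k)⁻ * (x (k - 1) - x k) := by
    unfold gridField upField ham; ring
  have h1 := abs_le.1 (hb k hk)
  have h2 := abs_le.1 (hb (N - k) (by omega))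
  have h3 := abs_le.1 (hb (k - 1) (by omega))
  have hp0 := negPart_nonneg (x (N - k) - x k)
  have hp : (x (N - k) - x k)⁻ ≤ η := negPart_le_of_neg_le hη (by linarith)
  have hp2 : (x (N - k) - x k)⁻ ≤ 2 := negPart_le_of_neg_le (by norm_num) (by linarith)
  set p := (x (N - k) - x k)⁻
  have hkN : (k : ℝ) ≤ N := by exact_mod_cast hk
  have h4 : |k * p * (x (k - 1) - x k)| ≤ N * η * 2 := by
    rw [abs_mul, abs_of_nonneg (by positivity : 0 ≤ k * p)]
    have : |x (k - 1) - x k| ≤ 2 := abs_le.2 ⟨by linarith, by linarith⟩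
    gcongr
  have h5 : p ^ 2 / 2 ≤ η := by nlinarith
  have h6 : 0 ≤ p ^ 2 / 2 := by positivity
  rw [e]
  rw [abs_le] at h4 ⊢
  constructor <;> linarith [h4.1, h4.2]

/-- The system is quasi-positive for the increments in the state of the player and in the state of
the others. -/
lemma IsGridValue.increments_nonneg {T : ℝ} {N : ℕ} {v : ℕ → ℝ → ℝ} (hv : IsGridValue T N v) :
    (∀ k ≤ N, N ≤ 2 * k → ∀ s ∈ Icc 0 T, v k s ≤ v (N - k) s) ∧
    (∀ k < N, N ≤ 2 * k → ∀ s ∈ Icc 0 T, v (k + 1) s ≤ v k s) := by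
  classical
  set S : Finset (Bool × ℕ) := (Finset.univ ×ˢ Finset.range (N + 1)).filter
    (fun i => N ≤ 2 * i.2 ∧ (i.1 = true → i.2 < N)) with hS
  have memZ : ∀ k, (false, k) ∈ S ↔ k ≤ N ∧ N ≤ 2 * k := fun k => by simp [hS]
  have memD : ∀ k, (true, k) ∈ S ↔ k < N ∧ N ≤ 2 * k := fun k => by simp [hS]; omega
  set w : Bool × ℕ → ℝ → ℝ := fun i s =>
    if i.1 then v (i.2 + 1) s - v i.2 s else v i.2 s - v (N - i.2) s with hw
  set w' : Bool × ℕ → ℝ → ℝ := fun i s =>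
    if i.1 then gridField N (fun j => v j s) (i.2 + 1) - gridField N (fun j => v j s) i.2
    else gridField N (fun j => v j s) i.2 - gridField N (fun j => v j s) (N - i.2) with hw'
  have hb := hv.abs_le_one
  -- At a positive maximum `η` of all increments the growth is at most `(2 N + 1) η + 2 N η + 2 N η`
  -- for an increment in the player's state, and `2 (2 N + 1) η + 2 N η` for one in the state of the
  -- others. The constant `6 N + 2` covers both; its size is irrelevant since the conclusion is a
  -- sign.
  have key := nonpos_of_deriv_le_mul_of_isMax (S := S) (w := w) (w' := w') (T := T)
    (L := 6 * N + 2) ?_ ?_ ?_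
  · refine ⟨fun k hk h2 s hs => ?_, fun k hk h2 s hs => ?_⟩
    · have := key (false, k) ((memZ k).2 ⟨hk, h2⟩) s hs
      simp only [hw, Bool.false_eq_true, if_false] at this
      linarith
    · have := key (true, k) ((memD k).2 ⟨hk, h2⟩) s hs
      simp only [hw, if_true] at this
      linarith
  · rintro ⟨_ | _, k⟩ hk s hs
    · have hk := (memZ k).1 hk
      simpa [hw, hw'] using (hv.deriv k hk.1 s hs).fun_sub (hv.deriv (N - k) (by omega) s hs)
    · have hk := (memD k).1 hk
      simpa [hw, hw'] using (hv.deriv (k + 1) (by omega) s hs).fun_sub (hv.deriv k (by omega) s hs)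
  · rintro ⟨_ | _, k⟩ hk
    · have hk := (memZ k).1 hk
      simp only [hw, Bool.false_eq_true, if_false]
      rw [hv.initial k hk.1, hv.initial (N - k) (by omega), Nat.cast_sub hk.1]
      have h2 : (N : ℝ) ≤ 2 * k := by exact_mod_cast hk.2
      have h3 : 2 * ((N : ℝ) - k) / N ≤ 2 * k / N := by gcongr; linarith
      linarith
    · have hk := (memD k).1 hk
      simp only [hw, if_true]
      rw [hv.initial (k + 1) (by omega), hv.initial k (by omega)]
      have h3 : 2 * (k : ℝ) / N ≤ 2 * (k + 1 : ℕ) / N := by push_cast; gcongr; linarith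
      linarith
  · rintro ⟨b, k⟩ hk s hs hm hp
    set η := w (b, k) s with hη
    set x : ℕ → ℝ := fun j => v j s with hx
    have hbx : ∀ j ≤ N, |x j| ≤ 1 := fun j hj => hb j hj s hs
    have hZ : ∀ j ≤ N, N ≤ 2 * j → x j - x (N - j) ≤ η := fun j hj h2 => by
      simpa [hw] using hm (false, j) ((memZ j).2 ⟨hj, h2⟩)
    have hD : ∀ j < N, N ≤ 2 * j → x (j + 1) - x j ≤ η := fun j hj h2 => by
      simpa [hw] using hm (true, j) ((memD j).2 ⟨hj, h2⟩)
    have hrate : ∀ j < N, 0 ≤ ((N - j : ℕ) : ℝ) * (x (j + 1) - x (N - (j + 1)))⁻ ∧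
        ((N - j : ℕ) : ℝ) * (x (j + 1) - x (N - (j + 1)))⁻ ≤ N * 2 := fun j hj => by
      have h1 := abs_le.1 (hbx (j + 1) (by omega))
      have h2 := abs_le.1 (hbx (N - (j + 1)) (by omega))
      have h3 : (x (j + 1) - x (N - (j + 1)))⁻ ≤ 2 :=
        negPart_le_of_neg_le (by norm_num) (by linarith)
      have h4 := negPart_nonneg (x (j + 1) - x (N - (j + 1)))
      refine ⟨by positivity, ?_⟩
      have : ((N - j : ℕ) : ℝ) ≤ N := by exact_mod_cast Nat.sub_le N j
      gcongr
    have hup : ∀ j ≤ N, N ≤ 2 * j → upField N x j ≤ N * 2 * η := fun j hj h2 => by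
      rcases hj.eq_or_lt with rfl | hj
      · simp only [upField, Nat.sub_self, Nat.cast_zero, zero_mul]
        positivity
      · have h3 := hrate j hj
        have h4 := hD j hj h2
        unfold upField
        calc _ ≤ ((N - j : ℕ) : ℝ) * (x (j + 1) - x (N - (j + 1)))⁻ * η :=
              mul_le_mul_of_nonneg_left h4 h3.1
          _ ≤ _ := mul_le_mul_of_nonneg_right h3.2 hp.le
    cases b
    · have hk := (memZ k).1 hk
      have hηe : η = x k - x (N - k) := by simp [hη, hw, hx]
      have h1 := abs_le.1 (abs_gridField_sub_upField_le hp.le hbx hk.1 (hZ k hk.1 hk.2))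
      have h2 := hup k hk.1 hk.2
      have hkN : N - (N - k) = k := by omega
      -- At the exact centre the increment in the player's state is zero, so it cannot be the
      -- positive maximum.
      have h2k : N ≠ 2 * k := by
        intro h
        have : N - k = k := by omega
        rw [this, sub_self] at hηe
        exact hp.ne' hηe
      have h3 : -(N * η * 2) ≤ gridField N x (N - k) := by
        have h0 : (x k - x (N - k))⁻ = 0 := negPart_eq_zero.2 (by linarith)
        have e : gridField N x (N - k) = (k : ℝ) * (x (N - k + 1) - x (k - 1))⁻
            * (x (N - k + 1) - x (N - k)) := by
          have h5 : N - (N - k + 1) = k - 1 := by omega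
          unfold gridField ham
          rw [hkN, h5, h0]
          ring
        have h5 : (x (N - k + 1) - x (k - 1))⁻ ≤ η := by
          refine negPart_le_of_neg_le hp.le ?_
          have h6 : N - k + 1 = N - (k - 1) := by omega
          -- Either `k - 1` is still in the upper half and its increment is bounded by the maximum,
          -- or `N = 2 k - 1` and the reflection exchanges `k - 1` and `k`, so that the increment
          -- changes sign.
          by_cases h7 : N ≤ 2 * (k - 1)
          · have := hZ (k - 1) (by omega) h7
            rw [h6]
            linarith
          · have h8 : N - (k - 1) = k := by omega
            have h9 : k - 1 = N - k := by omega
            rw [h6, h8, h9]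
            linarith
        have h6 := negPart_nonneg (x (N - k + 1) - x (k - 1))
        have h7 : |x (N - k + 1) - x (N - k)| ≤ 2 := by
          have h8 := abs_le.1 (hbx (N - k + 1) (by omega))
          have h9 := abs_le.1 (hbx (N - k) (by omega))
          exact abs_le.2 ⟨by linarith, by linarith⟩
        have hkN : (k : ℝ) ≤ N := by exact_mod_cast hk.1
        have h8 : |gridField N x (N - k)| ≤ N * η * 2 := by
          rw [e, abs_mul, abs_of_nonneg (by positivity)]
          gcongr
        exact (abs_le.1 h8).1
      simp only [hw', Bool.false_eq_true, if_false]
      nlinarith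
    · have hk := (memD k).1 hk
      have hηe : η = x (k + 1) - x k := by simp [hη, hw, hx]
      have h1 := abs_le.1 (abs_gridField_sub_upField_le hp.le hbx hk.1.le (hZ k hk.1.le hk.2))
      have h2 := abs_le.1 (abs_gridField_sub_upField_le hp.le hbx (k := k + 1) (by omega)
        (hZ (k + 1) (by omega) (by omega)))
      have h3 := hup (k + 1) (by omega) (by omega)
      have h4 : 0 ≤ upField N x k := by
        unfold upField
        exact mul_nonneg (hrate k hk.1).1 (by linarith)
      simp only [hw', if_true]
      nlinarith

/-! ### The reduced upwind system and comparison with it. -/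

/-- Above `1/2` only the players in state `-1` change their state. -/
lemma IsGridValue.deriv_upper {T : ℝ} {N : ℕ} {v : ℕ → ℝ → ℝ} (hv : IsGridValue T N v) {k : ℕ}
    (hk : k ≤ N) (h2 : N ≤ 2 * k) {s : ℝ} (hs : s ∈ Icc 0 T) :
    HasDerivWithinAt (v k) (((N - k : ℕ) : ℝ) * (v (N - (k + 1)) s - v (k + 1) s)
      * (v (k + 1) s - v k s)) (Icc 0 T) s := by
  convert hv.deriv k hk s hs using 1
  have h0 : (v (N - k) s - v k s)⁻ = 0 := by
    rw [negPart_eq_zero, sub_nonneg]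
    exact hv.increments_nonneg.1 k hk h2 s hs
  unfold gridField ham
  rw [h0]
  rcases hk.eq_or_lt with rfl | hk
  · simp
  · have h1 : (v (k + 1) s - v (N - (k + 1)) s)⁻ = v (N - (k + 1)) s - v (k + 1) s := by
      rw [← neg_sub, negPart_neg_of_nonneg]
      rw [sub_nonneg]
      exact hv.increments_nonneg.1 (k + 1) hk (by omega) s hs
    rw [h1]
    ring

/-- The last term, due to the players in state `-1`, is the only one that can look towards the
centre. It vanishes once `k - 1` is in the upper half (`deriv_lower`), and for `N + 1 = 2 k` it
becomes the damping in `deriv_center`. -/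
lemma IsGridValue.deriv_lower_aux {T : ℝ} {N : ℕ} {v : ℕ → ℝ → ℝ} (hv : IsGridValue T N v) {k : ℕ}
    (hk : k ≤ N) (h2 : N < 2 * k) {s : ℝ} (hs : s ∈ Icc 0 T) :
    HasDerivWithinAt (v (N - k)) (-((v (N - k) s - v k s) ^ 2 / 2)
      + ((N - k : ℕ) : ℝ) * (v (N - k) s - v k s) * (v (N - (k + 1)) s - v (N - k) s)
      + k * (v (N - (k - 1)) s - v (k - 1) s)⁻ * (v (N - (k - 1)) s - v (N - k) s))
      (Icc 0 T) s := by
  convert hv.deriv (N - k) (by omega) s hs using 1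
  have h1 : (v k s - v (N - k) s)⁻ = v (N - k) s - v k s := by
    rw [← neg_sub, negPart_neg_of_nonneg]
    rw [sub_nonneg]
    exact hv.increments_nonneg.1 k hk h2.le s hs
  have e1 : N - (N - k) = k := by omega
  have e2 : N - k - 1 = N - (k + 1) := by omega
  have e3 : N - k + 1 = N - (k - 1) := by omega
  have e4 : N - (N - (k - 1)) = k - 1 := by omega
  unfold gridField ham
  rw [e3, e1, e2, e4, h1]

lemma IsGridValue.deriv_lower {T : ℝ} {N : ℕ} {v : ℕ → ℝ → ℝ} (hv : IsGridValue T N v) {k : ℕ}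
    (hk : k ≤ N) (h2 : N ≤ 2 * (k - 1)) (hk0 : 1 ≤ k) {s : ℝ} (hs : s ∈ Icc 0 T) :
    HasDerivWithinAt (v (N - k)) (-((v (N - k) s - v k s) ^ 2 / 2)
      + ((N - k : ℕ) : ℝ) * (v (N - k) s - v k s) * (v (N - (k + 1)) s - v (N - k) s))
      (Icc 0 T) s := by
  convert hv.deriv_lower_aux hk (by omega) hs using 1
  have h0 : (v (N - (k - 1)) s - v (k - 1) s)⁻ = 0 := by
    rw [negPart_eq_zero, sub_nonneg]
    exact hv.increments_nonneg.1 (k - 1) (by omega) h2 s hs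
  rw [h0]
  ring

/-- At the two grid points closest to `1/2` the system has a strong damping. -/
lemma IsGridValue.deriv_center {T : ℝ} {N : ℕ} {v : ℕ → ℝ → ℝ} (hv : IsGridValue T N v) {k : ℕ}
    (hk : 1 ≤ k) (hN : N + 1 = 2 * k) {s : ℝ} (hs : s ∈ Icc 0 T) :
    HasDerivWithinAt (v (N - k)) (-((v (N - k) s - v k s) ^ 2 / 2)
      + ((N - k : ℕ) : ℝ) * (v (N - k) s - v k s) * (v (N - (k + 1)) s - v (N - k) s)
      - k * (v (N - k) s - v k s) ^ 2) (Icc 0 T) s := by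
  convert hv.deriv_lower_aux (k := k) (by omega) (by omega) hs using 1
  have e1 : N - (k - 1) = k := by omega
  have e2 : k - 1 = N - k := by omega
  have h0 : (v k s - v (N - k) s)⁻ = v (N - k) s - v k s := by
    rw [← neg_sub, negPart_neg_of_nonneg]
    rw [sub_nonneg]
    exact hv.increments_nonneg.1 k (by omega) (by omega) s hs
  rw [e1, e2, h0]
  ring

/-- Comparison of the values of the game with approximate solutions of the reduced system. -/
lemma IsGridValue.abs_sub_le {T : ℝ} {N : ℕ} {v : ℕ → ℝ → ℝ} (hv : IsGridValue T N v)
    {p q p' q' : ℕ → ℝ → ℝ} {k₀ : ℕ} (hk₀ : N ≤ 2 * (k₀ - 1)) (hk₀' : 1 ≤ k₀) {A R : ℝ}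
    (hA : 0 ≤ A) (hR : 0 ≤ R)
    (hp0 : ∀ k ≤ N, k₀ ≤ k → p k 0 = v k 0) (hq0 : ∀ k ≤ N, k₀ ≤ k → q k 0 = v (N - k) 0)
    (hz : ∀ k ≤ N, k₀ ≤ k → ∀ s ∈ Icc 0 T, |q k s - p k s| ≤ 2)
    (hp : ∀ k ≤ N, k₀ ≤ k → ∀ s ∈ Icc 0 T, HasDerivWithinAt (p k) (p' k s) (Icc 0 T) s)
    (hq : ∀ k ≤ N, k₀ ≤ k → ∀ s ∈ Icc 0 T, HasDerivWithinAt (q k) (q' k s) (Icc 0 T) s)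
    (hpA : ∀ k < N, k₀ ≤ k → ∀ s ∈ Icc 0 T, N * |p (k + 1) s - p k s| ≤ A)
    (hqA : ∀ k < N, k₀ ≤ k → ∀ s ∈ Icc 0 T, N * |q (k + 1) s - q k s| ≤ A)
    (hpR : ∀ k ≤ N, k₀ ≤ k → ∀ s ∈ Icc 0 T, |p' k s - ((N - k : ℕ) : ℝ)
      * (q (k + 1) s - p (k + 1) s) * (p (k + 1) s - p k s)| ≤ R)
    (hqR : ∀ k ≤ N, k₀ ≤ k → ∀ s ∈ Icc 0 T, |q' k s - (-((q k s - p k s) ^ 2 / 2)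
      + ((N - k : ℕ) : ℝ) * (q k s - p k s) * (q (k + 1) s - q k s))| ≤ R) :
    ∀ k ≤ N, k₀ ≤ k → ∀ s ∈ Icc 0 T,
      |v k s - p k s| ≤ R * Real.exp ((2 * A + 5) * T) ∧
      |v (N - k) s - q k s| ≤ R * Real.exp ((2 * A + 5) * T) := by
  set v' : ℕ → ℝ → ℝ := fun k s => ((N - k : ℕ) : ℝ) * (v (N - (k + 1)) s - v (k + 1) s)
      * (v (k + 1) s - v k s) with hv'
  set y' : ℕ → ℝ → ℝ := fun k s => -((v (N - k) s - v k s) ^ 2 / 2)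
      + ((N - k : ℕ) : ℝ) * (v (N - k) s - v k s) * (v (N - (k + 1)) s - v (N - k) s) with hy'
  set sg : Bool → ℝ := fun b => if b then 1 else -1 with hsg
  -- The first Boolean is the sign of an error, the second tells the value at `k` from the value at
  -- `N - k`. With both signs in one family, its maximum bounds all absolute errors.
  set S : Finset ((Bool × Bool) × ℕ) := Finset.univ ×ˢ Finset.Icc k₀ N with hS
  have memS : ∀ i, i ∈ S ↔ k₀ ≤ i.2 ∧ i.2 ≤ N := fun i => by simp [hS]
  set w : (Bool × Bool) × ℕ → ℝ → ℝ := fun i s =>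
    sg i.1.1 * if i.1.2 then v i.2 s - p i.2 s else v (N - i.2) s - q i.2 s with hw
  set w' : (Bool × Bool) × ℕ → ℝ → ℝ := fun i s =>
    sg i.1.1 * if i.1.2 then v' i.2 s - p' i.2 s else y' i.2 s - q' i.2 s with hw'
  -- An error `η` in each value makes an error `2 η` in the rate. It costs `2 η A` against the
  -- increments of the approximation, of size `A / N` with at most `N` players, and `4 η` in the
  -- quadratic running cost, as both increments are at most `2`.
  have key := le_mul_exp_of_deriv_le_of_isMax (S := S) (w := w) (w' := w') (T := T)
    (L := 2 * A + 4) (a := R) (by linarith) hR ?_ ?_ ?_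
  · intro k hk hk' s hs
    have e : 2 * A + 4 + 1 = 2 * A + 5 := by ring
    rw [e] at key
    have h1 := key ((true, true), k) ((memS _).2 ⟨hk', hk⟩) s hs
    have h2 := key ((false, true), k) ((memS _).2 ⟨hk', hk⟩) s hs
    have h3 := key ((true, false), k) ((memS _).2 ⟨hk', hk⟩) s hs
    have h4 := key ((false, false), k) ((memS _).2 ⟨hk', hk⟩) s hs
    simp only [hw, hsg, Bool.false_eq_true, if_false, if_true] at h1 h2 h3 h4
    rw [abs_le, abs_le]
    refine ⟨⟨?_, ?_⟩, ?_, ?_⟩ <;> linarith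
  · rintro ⟨⟨b, _ | _⟩, k⟩ hi s hs
    · have hk := (memS _).1 hi
      simpa [hw, hw'] using ((hv.deriv_lower hk.2 (by simp at hk; omega) (by simp at hk; omega)
        hs).sub (hq k hk.2 hk.1 s hs)).const_mul (sg b)
    · have hk := (memS _).1 hi
      simpa [hw, hw'] using ((hv.deriv_upper hk.2 (by simp at hk; omega)
        hs).sub (hp k hk.2 hk.1 s hs)).const_mul (sg b)
  · rintro ⟨⟨b, _ | _⟩, k⟩ hi
    · have hk := (memS _).1 hi
      simp [hw, hq0 k hk.2 hk.1]
    · have hk := (memS _).1 hi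
      simp [hw, hp0 k hk.2 hk.1]
  · rintro ⟨⟨b, c⟩, k⟩ hi s hs hm hpos
    have hk := (memS _).1 hi
    simp only at hk
    obtain ⟨hk1, hk2⟩ := hk
    set η := w ((b, c), k) s with hη
    have hsq : sg b = 1 ∨ sg b = -1 := by cases b <;> simp [hsg]
    have hsabs : |sg b| = 1 := by rcases hsq with h | h <;> simp [h]
    have he : ∀ j ≤ N, k₀ ≤ j → |v j s - p j s| ≤ η := fun j hj hj' => by
      have h1 := hm ((true, true), j) ((memS _).2 ⟨hj', hj⟩)
      have h2 := hm ((false, true), j) ((memS _).2 ⟨hj', hj⟩)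
      simp only [hw, hsg, Bool.false_eq_true, if_false, if_true] at h1 h2
      rw [abs_le]
      constructor <;> linarith
    have hg : ∀ j ≤ N, k₀ ≤ j → |v (N - j) s - q j s| ≤ η := fun j hj hj' => by
      have h1 := hm ((true, false), j) ((memS _).2 ⟨hj', hj⟩)
      have h2 := hm ((false, false), j) ((memS _).2 ⟨hj', hj⟩)
      simp only [hw, hsg, Bool.false_eq_true, if_false, if_true] at h1 h2
      rw [abs_le]
      constructor <;> linarith
    have hf : ∀ j ≤ N, k₀ ≤ j → |(v (N - j) s - v j s) - (q j s - p j s)| ≤ 2 * η :=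
      fun j hj hj' => by
        have h1 := abs_le.1 (he j hj hj')
        have h2 := abs_le.1 (hg j hj hj')
        rw [abs_le]
        constructor <;> linarith
    have hZ0 : ∀ j ≤ N, k₀ ≤ j → 0 ≤ v (N - j) s - v j s := fun j hj hj' =>
      sub_nonneg.2 (hv.increments_nonneg.1 j hj (by omega) s hs)
    have hZ2 : v (N - k) s - v k s ≤ 2 := by
      have h1 := abs_le.1 (hv.abs_le_one k hk2 s hs)
      have h2 := abs_le.1 (hv.abs_le_one (N - k) (by omega) s hs)
      linarith
    have hcast : ((N - k : ℕ) : ℝ) ≤ N := by exact_mod_cast Nat.sub_le N k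
    have hsgn : ∀ y : ℝ, sg b * y ≤ |y| := fun y => by
      calc sg b * y ≤ |sg b * y| := le_abs_self _
        _ = |y| := by rw [abs_mul, hsabs, one_mul]
    have hprod : ∀ f d : ℝ, |f| ≤ 2 * η → N * |d| ≤ A →
        |((N - k : ℕ) : ℝ) * f * d| ≤ 2 * η * A := fun f d hf hd => by
      rw [abs_mul, abs_mul, abs_of_nonneg (Nat.cast_nonneg _)]
      calc ((N - k : ℕ) : ℝ) * |f| * |d| ≤ N * (2 * η) * |d| := by gcongr
        _ = 2 * η * (N * |d|) := by ring
        _ ≤ 2 * η * A := by gcongr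
    cases c
    · have hηe : η = sg b * (v (N - k) s - q k s) := by simp [hη, hw]
      -- The first summand transports the error with a nonnegative rate and has a good sign at the
      -- maximum. The next two are linear in the error, and the last is the consistency error.
      have e : y' k s - q' k s
          = ((N - k : ℕ) : ℝ) * (v (N - k) s - v k s)
              * ((v (N - (k + 1)) s - q (k + 1) s) - (v (N - k) s - q k s))
            + ((N - k : ℕ) : ℝ) * ((v (N - k) s - v k s) - (q k s - p k s))
              * (q (k + 1) s - q k s)
            - ((v (N - k) s - v k s) - (q k s - p k s))
              * (((v (N - k) s - v k s) + (q k s - p k s)) / 2)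
            - (q' k s - (-((q k s - p k s) ^ 2 / 2)
              + ((N - k : ℕ) : ℝ) * (q k s - p k s) * (q (k + 1) s - q k s))) := by
        simp only [hy']; ring
      have t1 : sg b * (((N - k : ℕ) : ℝ) * (v (N - k) s - v k s)
          * ((v (N - (k + 1)) s - q (k + 1) s) - (v (N - k) s - q k s))) ≤ 0 := by
        rcases hk2.eq_or_lt with rfl | hk2
        · simp
        · have h1 : sg b * (v (N - (k + 1)) s - q (k + 1) s) ≤ η :=
            (hsgn _).trans (hg (k + 1) hk2 (by omega))
          have h2 := mul_nonneg (Nat.cast_nonneg (α := ℝ) (N - k)) (hZ0 k hk2.le hk1)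
          have h3 : ((N - k : ℕ) : ℝ) * (v (N - k) s - v k s)
              * (sg b * (v (N - (k + 1)) s - q (k + 1) s) - sg b * (v (N - k) s - q k s)) ≤ 0 :=
            mul_nonpos_of_nonneg_of_nonpos h2 (by linarith)
          linarith
      have t2 : |((N - k : ℕ) : ℝ) * ((v (N - k) s - v k s) - (q k s - p k s))
          * (q (k + 1) s - q k s)| ≤ 2 * η * A := by
        rcases hk2.eq_or_lt with rfl | hk2
        · simp; positivity
        · exact hprod _ _ (hf k hk2.le hk1) (hqA k hk2 hk1 s hs)
      have t3 : |((v (N - k) s - v k s) - (q k s - p k s))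
          * (((v (N - k) s - v k s) + (q k s - p k s)) / 2)| ≤ 2 * η * 2 := by
        rw [abs_mul]
        have h1 := hf k hk2 hk1
        have h2 : |((v (N - k) s - v k s) + (q k s - p k s)) / 2| ≤ 2 := by
          have h3 := abs_le.1 (hz k hk2 hk1 s hs)
          have h4 := hZ0 k hk2 hk1
          rw [abs_le]
          constructor <;> linarith
        gcongr
      have t4 := hqR k hk2 hk1 s hs
      simp only [hw', Bool.false_eq_true, if_false]
      rw [e, mul_sub, mul_sub, mul_add]
      have s2 := (hsgn _).trans t2
      have s3 := (hsgn _).trans ((abs_neg _).le.trans t3)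
      have s4 := (hsgn _).trans ((abs_neg _).le.trans t4)
      rw [mul_neg] at s3 s4
      linarith
    · have hηe : η = sg b * (v k s - p k s) := by simp [hη, hw]
      have e : v' k s - p' k s
          = ((N - k : ℕ) : ℝ) * (v (N - (k + 1)) s - v (k + 1) s)
              * ((v (k + 1) s - p (k + 1) s) - (v k s - p k s))
            + ((N - k : ℕ) : ℝ) * ((v (N - (k + 1)) s - v (k + 1) s)
                - (q (k + 1) s - p (k + 1) s)) * (p (k + 1) s - p k s)
            - (p' k s - ((N - k : ℕ) : ℝ)
              * (q (k + 1) s - p (k + 1) s) * (p (k + 1) s - p k s)) := by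
        simp only [hv']; ring
      have t1 : sg b * (((N - k : ℕ) : ℝ) * (v (N - (k + 1)) s - v (k + 1) s)
              * ((v (k + 1) s - p (k + 1) s) - (v k s - p k s))) ≤ 0 := by
        rcases hk2.eq_or_lt with rfl | hk2
        · simp
        · have h1 : sg b * (v (k + 1) s - p (k + 1) s) ≤ η :=
            (hsgn _).trans (he (k + 1) hk2 (by omega))
          have h2 := mul_nonneg (Nat.cast_nonneg (α := ℝ) (N - k)) (hZ0 (k + 1) hk2 (by omega))
          have h3 : ((N - k : ℕ) : ℝ) * (v (N - (k + 1)) s - v (k + 1) s)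
              * (sg b * (v (k + 1) s - p (k + 1) s) - sg b * (v k s - p k s)) ≤ 0 :=
            mul_nonpos_of_nonneg_of_nonpos h2 (by linarith)
          linarith
      have t2 : |((N - k : ℕ) : ℝ) * ((v (N - (k + 1)) s - v (k + 1) s)
                - (q (k + 1) s - p (k + 1) s)) * (p (k + 1) s - p k s)| ≤ 2 * η * A := by
        rcases hk2.eq_or_lt with rfl | hk2
        · simp; positivity
        · exact hprod _ _ (hf (k + 1) hk2 (by omega)) (hpA k hk2 hk1 s hs)
      have t4 := hpR k hk2 hk1 s hs
      simp only [hw', if_true]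
      rw [e, mul_sub, mul_add]
      have s2 := (hsgn _).trans t2
      have s4 := (hsgn _).trans ((abs_neg _).le.trans t4)
      rw [mul_neg] at s4
      have : 0 ≤ 4 * η := by positivity
      linarith

/-! ### Existence of the value functions. -/

/-- Bounded Lipschitz functions, an algebra on which the truncated system is built. -/
def IsBddLip {E : Type*} [NormedAddCommGroup E] (f : E → ℝ) : Prop :=
  ∃ B K : ℝ, 0 ≤ K ∧ (∀ x, |f x| ≤ B) ∧ ∀ x y, |f x - f y| ≤ K * ‖x - y‖

namespace IsBddLip

variable {E : Type*} [NormedAddCommGroup E] {f g : E → ℝ}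

lemma const (c : ℝ) : IsBddLip (fun _ : E => c) :=
  ⟨|c|, 0, le_rfl, fun _ => le_rfl, fun x y => by simp⟩

lemma add (hf : IsBddLip f) (hg : IsBddLip g) : IsBddLip (fun x => f x + g x) := by
  obtain ⟨B, K, hK, hB, hl⟩ := hf
  obtain ⟨B', K', hK', hB', hl'⟩ := hg
  refine ⟨B + B', K + K', by linarith, fun x => ?_, fun x y => ?_⟩
  · exact (abs_add_le _ _).trans (add_le_add (hB x) (hB' x))
  · calc _ = |(f x - f y) + (g x - g y)| := by ring_nf
      _ ≤ |f x - f y| + |g x - g y| := abs_add_le _ _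
      _ ≤ K * ‖x - y‖ + K' * ‖x - y‖ := add_le_add (hl x y) (hl' x y)
      _ = _ := by ring

lemma mul (hf : IsBddLip f) (hg : IsBddLip g) : IsBddLip (fun x => f x * g x) := by
  obtain ⟨B, K, hK, hB, hl⟩ := hf
  obtain ⟨B', K', hK', hB', hl'⟩ := hg
  have h0 : 0 ≤ B := (abs_nonneg _).trans (hB 0)
  have h0' : 0 ≤ B' := (abs_nonneg _).trans (hB' 0)
  refine ⟨B * B', B * K' + K * B', by positivity, fun x => ?_, fun x y => ?_⟩
  · rw [abs_mul]
    exact mul_le_mul (hB x) (hB' x) (abs_nonneg _) h0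
  · calc _ = |f x * (g x - g y) + (f x - f y) * g y| := by ring_nf
      _ ≤ |f x| * |g x - g y| + |f x - f y| * |g y| := by
        rw [← abs_mul, ← abs_mul]; exact abs_add_le _ _
      _ ≤ B * (K' * ‖x - y‖) + (K * ‖x - y‖) * B' := by
        have h1 := hB x
        have h2 := hB' y
        have h3 := hl x y
        have h4 := hl' x y
        gcongr
      _ = _ := by ring

lemma const_mul (c : ℝ) (hf : IsBddLip f) : IsBddLip (fun x => c * f x) := (const c).mul hf

lemma neg (hf : IsBddLip f) : IsBddLip (fun x => -f x) := by
  simpa using hf.const_mul (-1)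

lemma sub (hf : IsBddLip f) (hg : IsBddLip g) : IsBddLip (fun x => f x - g x) := by
  simpa [sub_eq_add_neg] using hf.add hg.neg

lemma negPart (hf : IsBddLip f) : IsBddLip (fun x => (f x)⁻) := by
  obtain ⟨B, K, hK, hB, hl⟩ := hf
  refine ⟨B, K, hK, fun x => ?_, fun x y => ?_⟩
  · rw [abs_of_nonneg (negPart_nonneg _)]
    exact negPart_le_of_neg_le ((abs_nonneg _).trans (hB x)) ((neg_le_abs _).trans (hB x))
  · refine le_trans ?_ (hl x y)
    simp only [negPart_def]
    refine (abs_max_sub_max_le_abs _ _ _).trans ?_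
    rw [neg_sub_neg, abs_sub_comm]

end IsBddLip

/-- The projection of the real line onto `[-1, 1]`. -/
def cutoff (y : ℝ) : ℝ := max (-1) (min 1 y)

lemma cutoff_mono : Monotone cutoff := fun _ _ h =>
  max_le_max le_rfl (min_le_min le_rfl h)

lemma cutoff_of_abs_le {y : ℝ} (h : |y| ≤ 1) : cutoff y = y := by
  have := abs_le.1 h
  rw [cutoff, min_eq_right this.2, max_eq_right this.1]

lemma isBddLip_cutoff_apply {ι : Type*} [Fintype ι] (i : ι) :
    IsBddLip (fun x : ι → ℝ => cutoff (x i)) := by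
  refine ⟨1, 1, zero_le_one, fun x => ?_, fun x y => ?_⟩
  · rw [abs_le]
    exact ⟨le_max_left _ _, max_le (by norm_num) (min_le_left _ _)⟩
  · rw [one_mul]
    refine le_trans ?_ (norm_le_pi_norm (x - y) i)
    simp only [cutoff, max_comm (-1 : ℝ), min_comm (1 : ℝ)]
    refine (abs_max_sub_max_le_abs _ _ _).trans ?_
    exact abs_inf_sub_inf_le_abs _ _ _

lemma isBddLip_gridField {E : Type*} [NormedAddCommGroup E] {x : E → ℕ → ℝ}
    (hx : ∀ j, IsBddLip (fun e => x e j)) (N k : ℕ) : IsBddLip (fun e => gridField N (x e) k) := by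
  have h1 := ((hx (N - k)).sub (hx k)).negPart
  have h2 := ((h1.mul h1).const_mul (1 / 2)).neg
  have h3 := (h1.const_mul k).mul ((hx (k - 1)).sub (hx k))
  have h4 := (((hx (k + 1)).sub (hx (N - (k + 1)))).negPart.const_mul ((N - k : ℕ) : ℝ)).mul
    ((hx (k + 1)).sub (hx k))
  convert (h2.add h3).add h4 using 2
  unfold gridField ham
  ring

/-- With its arguments cut off to `[-1, 1]` the field is bounded and globally Lipschitz, so
Picard-Lindelöf reaches time `T`. The maximum principle keeps the solution in `[-1, 1]`, where the
cut-off is the identity. -/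
lemma exists_isGridValue {T : ℝ} (hT : 0 ≤ T) (N : ℕ) : ∃ v, IsGridValue T N v := by
  -- Indices beyond `N` are clamped; in `gridField` they come with the factor zero.
  let ix : ℕ → Fin (N + 1) := fun j => ⟨min j N, by omega⟩
  let F : (Fin (N + 1) → ℝ) → (Fin (N + 1) → ℝ) := fun x k =>
    gridField N (fun j => cutoff (x (ix j))) k
  have hF : ∀ k : Fin (N + 1), IsBddLip (fun x => F x k) := fun k =>
    isBddLip_gridField (fun j => isBddLip_cutoff_apply (ix j)) N k
  choose B K hK hB hl using hF
  have hB0 : ∀ k, 0 ≤ B k := fun k => (abs_nonneg _).trans (hB k 0)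
  set B' : NNReal := ⟨∑ k, B k, Finset.sum_nonneg fun k _ => hB0 k⟩ with hB'
  set K' : NNReal := ⟨∑ k, K k, Finset.sum_nonneg fun k _ => hK k⟩ with hK'
  have hbound : ∀ x, ‖F x‖ ≤ B' := fun x => by
    refine (pi_norm_le_iff_of_nonneg B'.2).2 fun k => (hB k x).trans ?_
    exact Finset.single_le_sum (fun k _ => hB0 k) (Finset.mem_univ k)
  have hlip : LipschitzWith K' F := by
    refine LipschitzWith.of_dist_le_mul fun x y => ?_
    rw [dist_eq_norm, dist_eq_norm]
    refine (pi_norm_le_iff_of_nonneg (by positivity)).2 fun k => (hl k x y).trans ?_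
    refine mul_le_mul_of_nonneg_right ?_ (norm_nonneg _)
    exact Finset.single_le_sum (fun k _ => hK k) (Finset.mem_univ k)
  let x₀ : Fin (N + 1) → ℝ := fun k => 1 - 2 * (k : ℕ) / N
  -- The radius `B' * T` is the distance that a solution with speed at most `B'` can cover by time
  -- `T`.
  have hPL : IsPicardLindelof (fun _ => F) (tmin := 0) (tmax := T) ⟨0, left_mem_Icc.2 hT⟩ x₀
      (B' * ⟨T, hT⟩) 0 B' K' :=
    { lipschitzOnWith := fun _ _ => hlip.lipschitzOnWith
      continuousOn := fun _ _ => continuousOn_const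
      norm_le := fun _ _ x _ => hbound x
      mul_max_le := by
        simp only [sub_zero, sub_self, max_eq_left hT, NNReal.coe_zero]
        exact le_rfl }
  obtain ⟨α, hα0, hα⟩ := hPL.exists_eq_forall_mem_Icc_hasDerivWithinAt₀
  have hix : ∀ k ≤ N, ((ix k : Fin (N + 1)) : ℕ) = k := fun k hk => min_eq_left hk
  let v : ℕ → ℝ → ℝ := fun j s => α s (ix j)
  have hv0 : ∀ k ≤ N, v k 0 = 1 - 2 * k / N := fun k hk => by
    have : α 0 = x₀ := hα0
    simp only [v, this, x₀, hix k hk]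
  have hv : ∀ k ≤ N, ∀ s ∈ Icc 0 T,
      HasDerivWithinAt (v k) (gridField N (fun j => cutoff (v j s)) k) (Icc 0 T) s :=
    fun k hk s hs => by
      have h1 := hasDerivWithinAt_pi.1 (hα s hs) (ix k)
      simp only [F, hix k hk] at h1
      exact h1
  have hb := abs_le_one_of_monotone cutoff_mono hv0 hv
  have hb' : ∀ j, ∀ s ∈ Icc 0 T, |v j s| ≤ 1 := fun j s hs => by
    have h1 : v j s = v (min j N) s := by simp [v, ix]
    rw [h1]
    exact hb _ (min_le_right _ _) s hs
  refine ⟨v, hv0, fun k hk s hs => ?_⟩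
  have h1 := hv k hk s hs
  have h2 : (fun j => cutoff (v j s)) = fun j => v j s :=
    funext fun j => cutoff_of_abs_le (hb' j s hs)
  rwa [h2] at h1

/-- Truncated subtraction of indices and subtraction of grid points disagree only at `k = 0` and `k
= N`, where the factor in front is zero. -/
lemma gridField_eq {N k : ℕ} (hN : 1 ≤ N) (hk : k ≤ N) (x : ℝ → ℝ) :
    gridField N (fun j => x (j / N)) k =
      -ham (x (1 - k / N) - x (k / N))
      + N * (k / N) * (x (1 - k / N) - x (k / N))⁻ * (x (k / N - 1 / N) - x (k / N))
      + N * (1 - k / N) * (x (k / N + 1 / N) - x (1 - k / N - 1 / N))⁻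
        * (x (k / N + 1 / N) - x (k / N)) := by
  have hN0 : (N : ℝ) ≠ 0 := by positivity
  have e1 : ((N - k : ℕ) : ℝ) / N = 1 - k / N := by
    rw [Nat.cast_sub hk]
    field_simp
  have e2 : ((k + 1 : ℕ) : ℝ) / N = k / N + 1 / N := by
    push_cast
    ring
  have e3 : (N : ℝ) * (k / N) = k := by field_simp
  have e4 : (N : ℝ) * (1 - k / N) = ((N - k : ℕ) : ℝ) := by
    rw [Nat.cast_sub hk]
    field_simp
  unfold gridField
  simp only [e1, e2, e3, e4]
  congr 1
  · rcases Nat.eq_zero_or_pos k with rfl | hk0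
    · simp
    · rw [Nat.cast_sub (show 1 ≤ k from hk0), Nat.cast_one, sub_div]
  · rcases hk.eq_or_lt with rfl | hk
    · simp
    · rw [Nat.cast_sub (show k + 1 ≤ N from hk)]
      have : ((N : ℝ) - (k + 1 : ℕ)) / N = 1 - k / N - 1 / N := by
        push_cast
        field_simp
        ring
      rw [this]

lemma HasDerivWithinAt.comp_time_reversal {T : ℝ} {f : ℝ → ℝ} {f' s : ℝ}
    (h : HasDerivWithinAt f f' (Icc 0 T) (T - s)) :
    HasDerivWithinAt (fun s => f (T - s)) (-f') (Icc 0 T) s := by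
  have h1 : HasDerivWithinAt (fun s : ℝ => T - s) (-1) (Icc 0 T) s :=
    ((hasDerivAt_id s).const_sub T).hasDerivWithinAt
  have h2 : MapsTo (fun s : ℝ => T - s) (Icc 0 T) (Icc 0 T) := fun s hs =>
    ⟨by linarith [hs.2], by linarith [hs.1]⟩
  have h3 := HasDerivWithinAt.scomp s h h1 h2
  rw [neg_one_smul] at h3
  exact h3

lemma IsNashValue.isGridValue {T : ℝ} {N : ℕ} (hN : 1 ≤ N) {V : ℝ → ℝ → ℝ}
    (hV : IsNashValue T N V) : IsGridValue T N (fun k s => V (T - s) (k / N)) := by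
  refine ⟨fun k hk => ?_, fun k hk s hs => ?_⟩
  · have := hV.terminal (k / N) ⟨k, hk, rfl⟩
    simp only [sub_zero, this]
    ring
  · have hs' : T - s ∈ Icc 0 T := ⟨by linarith [hs.2], by linarith [hs.1]⟩
    have hd := (hV.diff (k / N) ⟨k, hk, rfl⟩ (T - s) hs').hasDerivWithinAt
    have he := hV.equation (T - s) hs' (k / N) ⟨k, hk, rfl⟩
    refine (HasDerivWithinAt.comp_time_reversal hd).congr_deriv ?_
    rw [gridField_eq hN hk (V (T - s))]
    linarith

lemma exists_isNashValue {T : ℝ} (hT : 0 < T) {N : ℕ} (hN : 1 ≤ N) :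
    ∃ V, IsNashValue T N V := by
  obtain ⟨v, hv⟩ := exists_isGridValue hT.le N
  have hfl : ∀ k : ℕ, ⌊(k : ℝ) / N * N⌋₊ = k := fun k => by
    have : (N : ℝ) ≠ 0 := by positivity
    rw [div_mul_cancel₀ _ this, Nat.floor_natCast]
  have hd : ∀ k ≤ N, ∀ t ∈ Icc 0 T, HasDerivWithinAt (fun t => v ⌊(k : ℝ) / N * N⌋₊ (T - t))
      (-gridField N (fun j => v ⌊(j : ℝ) / N * N⌋₊ (T - t)) k) (Icc 0 T) t := fun k hk t ht => by
    simp only [hfl]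
    exact HasDerivWithinAt.comp_time_reversal
      (hv.deriv k hk (T - t) ⟨by linarith [ht.2], by linarith [ht.1]⟩)
  refine ⟨fun t μ => v ⌊μ * N⌋₊ (T - t), ?_, ?_, ?_⟩
  · rintro μ ⟨k, hk, rfl⟩ t ht
    exact (hd k hk t ht).differentiableWithinAt
  · rintro t ht μ ⟨k, hk, rfl⟩
    rw [(hd k hk t ht).derivWithin (uniqueDiffOn_Icc hT t ht),
      gridField_eq hN hk (fun μ => v ⌊μ * N⌋₊ (T - t))]
    ring
  · rintro μ ⟨k, hk, rfl⟩
    simp only [hfl, sub_self, hv.initial k hk]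
    ring

/-! ### Uniqueness along the characteristics. -/

/-- Partial derivatives of a `C¹` function on `[0,T] × (0,1]`, and the chain rule along curves. -/
lemma exists_partial_derivs {T : ℝ} (hT : 0 < T) {f : ℝ → ℝ → ℝ}
    (hf : ContDiffOn ℝ 1 (fun p : ℝ × ℝ => f p.1 p.2) (Icc 0 T ×ˢ Ioc 0 1)) :
    ∃ ft fm : ℝ → ℝ → ℝ,
      ContinuousOn (fun p : ℝ × ℝ => fm p.1 p.2) (Icc 0 T ×ˢ Ioc 0 1) ∧
      (∀ t ∈ Icc 0 T, ∀ m ∈ Ioc (0 : ℝ) 1,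
        HasDerivWithinAt (fun s => f s m) (ft t m) (Icc 0 T) t ∧
        HasDerivWithinAt (f t) (fm t m) (Ioc 0 1) m) ∧
      ∀ (I : Set ℝ) (x : ℝ → ℝ), I ⊆ Icc 0 T → MapsTo x I (Ioc 0 1) → ∀ s ∈ I, ∀ x',
        HasDerivWithinAt x x' I s →
        HasDerivWithinAt (fun s => f s (x s)) (ft s (x s) + x' * fm s (x s)) I s := by
  set S : Set (ℝ × ℝ) := Icc 0 T ×ˢ Ioc 0 1
  set F : ℝ × ℝ → ℝ := fun p => f p.1 p.2 with hF
  have hu : UniqueDiffOn ℝ S := (uniqueDiffOn_Icc hT).prod (uniqueDiffOn_Ioc 0 1)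
  have hd : ∀ p ∈ S, HasFDerivWithinAt F (fderivWithin ℝ F S p) S p := fun p hp =>
    (hf.differentiableOn one_ne_zero p hp).hasFDerivWithinAt
  have hcurve : ∀ (I : Set ℝ) (x : ℝ → ℝ), I ⊆ Icc 0 T → MapsTo x I (Ioc 0 1) → ∀ s ∈ I, ∀ x',
        HasDerivWithinAt x x' I s →
        HasDerivWithinAt (fun s => f s (x s)) (fderivWithin ℝ F S (s, x s) (1, 0)
          + x' * fderivWithin ℝ F S (s, x s) (0, 1)) I s := by
    intro I x hI hx s hs x' hx'
    have h := (hd (s, x s) ⟨hI hs, hx hs⟩).comp_hasDerivWithinAt s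
      ((hasDerivWithinAt_id s I).prodMk hx')
      (show MapsTo (fun r => (r, x r)) I S from fun r hr => ⟨hI hr, hx hr⟩)
    refine h.congr_deriv ?_
    have e : ((1 : ℝ), x') = (1, 0) + x' • ((0 : ℝ), (1 : ℝ)) := by simp
    rw [e, map_add, map_smul, smul_eq_mul]
  refine ⟨fun t m => fderivWithin ℝ F S (t, m) (1, 0), fun t m => fderivWithin ℝ F S (t, m) (0, 1),
    (hf.continuousOn_fderivWithin hu le_rfl).clm_apply continuousOn_const,
    fun t ht m hm => ⟨?_, ?_⟩, hcurve⟩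
  · simpa using hcurve (Icc 0 T) (fun _ => m) Subset.rfl (fun _ _ => hm) t ht 0
      (hasDerivWithinAt_const t _ m)
  · exact (hd (t, m) ⟨ht, hm⟩).comp_hasDerivWithinAt m
      ((hasDerivWithinAt_const m _ t).prodMk (hasDerivWithinAt_id m _))
      (show MapsTo (fun r => (t, r)) (Ioc 0 1) S from fun r hr => ⟨ht, hr⟩)

lemma Ioc_mem_nhdsWithin_Icc {m : ℝ} (hm : m ∈ Ioc (0 : ℝ) 1) : Ioc (0 : ℝ) 1 ∈ 𝓝[Icc (-1) 1] m := by
  filter_upwards [mem_nhdsWithin_of_mem_nhds (Ioi_mem_nhds hm.1), self_mem_nhdsWithin] with y h1 h2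
  exact ⟨h1, h2.2⟩

/-- The sign of an arbitrary solution is not known in advance, so `z |z|` has to be differentiated
at `z = 0` as well. -/
lemma hasDerivAt_mul_abs (x : ℝ) : HasDerivAt (fun x : ℝ => x * |x|) (2 * |x|) x := by
  rcases lt_trichotomy x 0 with h | rfl | h
  · have h1 : HasDerivAt (fun x : ℝ => -(x ^ 2)) (2 * |x|) x := by
      refine (hasDerivAt_pow 2 x).neg.congr_deriv ?_
      rw [abs_of_neg h]
      simp
    refine h1.congr_of_eventuallyEq ?_
    filter_upwards [Iio_mem_nhds h] with y hy
    rw [abs_of_neg hy]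
    ring
  · rw [hasDerivAt_iff_tendsto_slope]
    have h1 : Tendsto (fun y : ℝ => |y|) (𝓝[≠] 0) (𝓝 (2 * |(0 : ℝ)|)) := by
      have := continuous_abs.tendsto (0 : ℝ)
      simp only [abs_zero, mul_zero] at this ⊢
      exact this.mono_left nhdsWithin_le_nhds
    refine h1.congr' ?_
    filter_upwards [self_mem_nhdsWithin] with y hy
    have : y ≠ 0 := hy
    simp [slope_def_field, this]
  · have h1 : HasDerivAt (fun x : ℝ => x ^ 2) (2 * |x|) x := by
      refine (hasDerivAt_pow 2 x).congr_deriv ?_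
      rw [abs_of_pos h]
      simp
    refine h1.congr_of_eventuallyEq ?_
    filter_upwards [Ioi_mem_nhds h] with y hy
    rw [abs_of_pos hy]
    ring

lemma hasDerivWithinAt_flux {f : ℝ → ℝ} {f' m : ℝ} {S : Set ℝ} (hf : HasDerivWithinAt f f' S m) :
    HasDerivWithinAt (fun y => flux y (f y))
      (f m * |f m| / 2 + m * |f m| * f' - f m * f') S m := by
  have h1 := (hasDerivAt_mul_abs (f m)).comp_hasDerivWithinAt m hf
  have h2 := (((hasDerivWithinAt_id m S).mul h1).div_const 2).sub ((hf.pow 2).div_const 2)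
  refine h2.congr_deriv ?_
  simp
  ring

lemma hasDerivAt_charVal_time {t x : ℝ} (ht : 0 ≤ t) (hx : 0 ≤ x) :
    HasDerivAt (fun s => charVal s x) (-(charVal t x ^ 2 / 2)) t := by
  have h0 : 1 + x * t ≠ 0 := by positivity
  have h1 : HasDerivAt (fun s : ℝ => 1 + x * s) x t := by
    simpa using ((hasDerivAt_id t).const_mul x).const_add 1
  refine ((hasDerivAt_const t (2 * x)).div h1 h0).congr_deriv ?_
  unfold charVal
  field_simp
  ring

lemma hasDerivAt_charPos_time' {t x : ℝ} (ht : 0 ≤ t) (hx : 0 ≤ x) :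
    HasDerivAt (fun s => charPos s x) (-((1 - charPos t x) * charVal t x)) t := by
  refine (hasDerivAt_charPos_time t x).congr_deriv ?_
  have h0 : 1 + x * t ≠ 0 := by positivity
  unfold charPos charVal
  field_simp
  ring

lemma charPos_mem_of_le {s t m : ℝ} (hs : 0 ≤ s) (hst : s ≤ t) (hm : m ∈ Ioc (0 : ℝ) 1) :
    charPos s (charFoot t m) ∈ Ioc (0 : ℝ) 1 := by
  have hx := charFoot_mem (t := t) hm
  refine ⟨lt_of_lt_of_le hm.1 ?_, charPos_le_one hx.2⟩
  have := charPos_anti hs hst hx.1.le hx.2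
  rwa [charPos_charFoot hm] at this

lemma continuousOn_charPos_time (x : ℝ) (S : Set ℝ) : ContinuousOn (fun s => charPos s x) S :=
  (continuous_iff_continuousAt.2 fun s => (hasDerivAt_charPos_time s x).continuousAt).continuousOn

/-- A classical solution on the right of the shock is determined by the characteristics. -/
lemma eq_charVal_of_conservationLaw {T : ℝ} (hT : 0 < T) {Z : ℝ → ℝ → ℝ}
    (hs : ContDiffOn ℝ 1 (fun p : ℝ × ℝ => Z p.1 p.2) (Icc 0 T ×ˢ Ioc 0 1))
    (he : ∀ t ∈ Icc 0 T, ∀ m ∈ Ioc (0 : ℝ) 1, derivWithin (fun s => Z s m) (Icc 0 T) t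
      + derivWithin (fun y => flux y (Z t y)) (Icc (-1) 1) m = 0)
    (h0 : ∀ m ∈ Ioc (0 : ℝ) 1, Z 0 m = 2 * m) {t m : ℝ} (ht : t ∈ Icc 0 T)
    (hm : m ∈ Ioc (0 : ℝ) 1) : Z t m = charVal t (charFoot t m) := by
  obtain ⟨Zt, Zm, hZm, hpart, hchain⟩ := exists_partial_derivs hT hs
  set x₀ := charFoot t m with hx₀
  have hx := charFoot_mem (t := t) hm
  have hI : Icc 0 t ⊆ Icc 0 T := Icc_subset_Icc le_rfl ht.2
  set x : ℝ → ℝ := fun s => charPos s x₀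
  have hmaps : MapsTo x (Icc 0 t) (Ioc 0 1) := fun s hs => charPos_mem_of_le hs.1 hs.2 hm
  have hxc : ContinuousOn x (Icc 0 t) := continuousOn_charPos_time x₀ _
  have hpath : ContinuousOn (fun s => (s, x s)) (Icc 0 t) := continuousOn_id.prodMk hxc
  have hpm : MapsTo (fun s => (s, x s)) (Icc 0 t) (Icc 0 T ×ˢ Ioc 0 1) :=
    fun s hs => ⟨hI hs, hmaps hs⟩
  obtain ⟨A, hA⟩ := isCompact_Icc.exists_bound_of_continuousOn (hs.continuousOn.comp hpath hpm)
  obtain ⟨B, hB⟩ := isCompact_Icc.exists_bound_of_continuousOn (hZm.comp hpath hpm)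
  -- The curve is the explicit characteristic, not one defined through `Z`. The mismatch of speeds
  -- multiplies `Zm`, which is bounded on the compact path, so every term is at most a constant
  -- times `|Z - charVal|`, and a difference that starts at zero stays zero.
  have hd : ∀ s ∈ Icc 0 t, HasDerivWithinAt (fun s => Z s (x s) - charVal s x₀)
      (-(Z s (x s) * |Z s (x s)| - charVal s x₀ * charVal s x₀) / 2
        - Zm s (x s) * (x s * (|Z s (x s)| - charVal s x₀) - (Z s (x s) - charVal s x₀)))
      (Icc 0 t) s := by
    intro s hs
    have h1 := hchain (Icc 0 t) x hI hmaps s hs _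
      (hasDerivAt_charPos_time' hs.1 hx.1.le).hasDerivWithinAt
    refine (h1.sub (hasDerivAt_charVal_time hs.1 hx.1.le).hasDerivWithinAt).congr_deriv ?_
    have h2 := he s (hI hs) (x s) (hmaps hs)
    obtain ⟨h3, h4⟩ := hpart s (hI hs) (x s) (hmaps hs)
    have h5 := (hasDerivWithinAt_flux h4).mono_of_mem_nhdsWithin
      (Ioc_mem_nhdsWithin_Icc (hmaps hs))
    have hm' := hmaps hs
    rw [h3.derivWithin (uniqueDiffOn_Icc hT s (hI hs)), h5.derivWithin
      (uniqueDiffOn_Icc (by norm_num) _ ⟨by linarith [hm'.1], hm'.2⟩)] at h2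
    have h6 : charPos s x₀ = x s := rfl
    rw [h6]
    linear_combination h2
  have hz : ∀ s ∈ Icc 0 t, 0 ≤ charVal s x₀ ∧ charVal s x₀ ≤ 2 := fun s hs => by
    have := charVal_le hs.1 hx.1.le
    exact ⟨charVal_nonneg hs.1 hx.1.le, by linarith [hx.2]⟩
  have key := eq_zero_of_abs_deriv_le_mul_abs_self_of_eq_zero_right (K := (A + 2) / 2 + 2 * B)
    (a := 0) (b := t)
    (fun s hs => (hd s hs).continuousWithinAt)
    (fun s hs => (hd s (Ico_subset_Icc_self hs)).mono_of_mem_nhdsWithin (Icc_mem_nhdsGE_of_mem hs))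
    (by simp [x, charPos_zero_left, h0 x₀ hx, charVal]) ?_ t (right_mem_Icc.2 ht.1)
  · have h1 : x t = m := charPos_charFoot hm
    simp only [h1] at key
    linarith
  · intro s hs
    have hs' := Ico_subset_Icc_self hs
    have hA' := hA s hs'
    have hB' := hB s hs'
    have hx' := hmaps hs'
    obtain ⟨hz0, hz2⟩ := hz s hs'
    simp only [Real.norm_eq_abs, Function.comp_def] at hA' hB' ⊢
    set z := Z s (x s)
    set ζ := charVal s x₀
    have h1 : |(|z| - ζ)| ≤ |z - ζ| := by
      have := abs_abs_sub_abs_le_abs_sub z ζ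
      rwa [abs_of_nonneg hz0] at this
    have h2 : |z * |z| - ζ * ζ| ≤ (A + 2) * |z - ζ| := by
      have e : z * |z| - ζ * ζ = (z - ζ) * |z| + ζ * (|z| - ζ) := by ring
      rw [e]
      calc _ ≤ |(z - ζ) * (|z|)| + |ζ * (|z| - ζ)| := abs_add_le _ _
        _ = |z - ζ| * |z| + ζ * |(|z| - ζ)| := by rw [abs_mul, abs_mul, abs_abs, abs_of_nonneg hz0]
        _ ≤ |z - ζ| * A + 2 * |z - ζ| := by gcongr
        _ = _ := by ring
    have h3 : |x s * (|z| - ζ) - (z - ζ)| ≤ 2 * |z - ζ| := by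
      calc _ ≤ |x s * (|z| - ζ)| + |z - ζ| := abs_sub _ _
        _ ≤ 1 * |z - ζ| + |z - ζ| := by
          rw [abs_mul, abs_of_pos hx'.1]
          gcongr
          exact hx'.2
        _ = _ := by ring
    have hB0 : 0 ≤ B := (abs_nonneg _).trans hB'
    calc _ ≤ |(-(z * |z| - ζ * ζ) / 2)| + |Zm s (x s) * (x s * (|z| - ζ) - (z - ζ))| := abs_sub _ _
      _ = |z * |z| - ζ * ζ| / 2 + |Zm s (x s)| * |x s * (|z| - ζ) - (z - ζ)| := by
        rw [abs_mul, abs_div, abs_neg, abs_two]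
      _ ≤ (A + 2) * |z - ζ| / 2 + B * (2 * |z - ζ|) := by gcongr
      _ = _ := by ring

/-- The value of a player in the majority state is transported along the characteristics. -/
lemma eq_neg_charFoot_of_transport {T : ℝ} (hT : 0 < T) {u : ℝ → ℝ → ℝ}
    (hs : ContDiffOn ℝ 1 (fun p : ℝ × ℝ => u p.1 p.2) (Icc 0 T ×ˢ Ioc 0 1))
    (he : ∀ t ∈ Icc 0 T, ∀ m ∈ Ioc (0 : ℝ) 1, -derivWithin (fun s => u s m) (Icc 0 T) t
      - derivWithin (fun s => u t (m + 2 * s)) (Ici 0) 0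
        * charVal (T - t) (charFoot (T - t) m) * ((1 - m) / 2) = 0)
    (h0 : ∀ m ∈ Ioc (0 : ℝ) 1, u T m = -m) {t m : ℝ} (ht : t ∈ Icc 0 T)
    (hm : m ∈ Ioc (0 : ℝ) 1) : u t m = -charFoot (T - t) m := by
  set w : ℝ → ℝ → ℝ := fun s m => u (T - s) m with hw
  have hws : ContDiffOn ℝ 1 (fun p : ℝ × ℝ => w p.1 p.2) (Icc 0 T ×ˢ Ioc 0 1) := by
    refine hs.comp (f := fun p : ℝ × ℝ => (T - p.1, p.2)) (by fun_prop) ?_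
    rintro ⟨s, m⟩ ⟨hs, hm⟩
    exact ⟨⟨by linarith [hs.2], by linarith [hs.1]⟩, hm⟩
  obtain ⟨wt, wm, -, hpart, hchain⟩ := exists_partial_derivs hT hws
  have hflip : ∀ s ∈ Icc 0 T, T - s ∈ Icc 0 T := fun s hs =>
    ⟨by linarith [hs.2], by linarith [hs.1]⟩
  have heq : ∀ s ∈ Icc 0 T, ∀ m ∈ Ioc (0 : ℝ) 1,
      wt s m - (1 - m) * charVal s (charFoot s m) * wm s m = 0 := by
    intro s hs m hm
    obtain ⟨h1, h2⟩ := hpart s hs m hm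
    have h3 := he (T - s) (hflip s hs) m hm
    have h1' : HasDerivWithinAt (fun s => u s m) (-wt s m) (Icc 0 T) (T - s) := by
      have := HasDerivWithinAt.comp_time_reversal (T := T) (s := T - s) (f := fun s => w s m)
        (f' := wt s m) (by simpa using h1)
      simpa [hw] using this
    rw [h1'.derivWithin (uniqueDiffOn_Icc hT _ (hflip s hs)), sub_sub_cancel] at h3
    -- At `m = 1` the increment `m + 2 s` leaves the domain, but the coefficient `1 - m` vanishes.
    rcases hm.2.eq_or_lt with rfl | hm1
    · simp at h3 ⊢
      exact h3
    · have h4 : HasDerivAt (w s) (wm s m) m := h2.hasDerivAt (Ioc_mem_nhds hm.1 hm1)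
      have h5 : HasDerivAt (fun r : ℝ => m + 2 * r) 2 0 := by
        simpa using ((hasDerivAt_id (0 : ℝ)).const_mul 2).const_add m
      have h6 : HasDerivAt (fun r => w s (m + 2 * r)) (wm s m * 2) 0 :=
        HasDerivAt.comp (h := fun r : ℝ => m + 2 * r) (h₂ := w s) 0 (by simpa using h4) h5
      rw [h6.hasDerivWithinAt.derivWithin (uniqueDiffOn_Ici 0 0 self_mem_Ici)] at h3
      linear_combination h3
  set τ := T - t with hτ
  have hτT : τ ∈ Icc 0 T := hflip t ht
  set x₀ := charFoot τ m with hx₀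
  have hx := charFoot_mem (t := τ) hm
  have hI : Icc 0 τ ⊆ Icc 0 T := Icc_subset_Icc le_rfl hτT.2
  have hmaps : MapsTo (fun s => charPos s x₀) (Icc 0 τ) (Ioc 0 1) :=
    fun s hs => charPos_mem_of_le hs.1 hs.2 hm
  have hd : ∀ s ∈ Icc 0 τ, HasDerivWithinAt (fun s => w s (charPos s x₀)) 0 (Icc 0 τ) s := by
    intro s hs
    refine (hchain (Icc 0 τ) _ hI hmaps s hs _
      (hasDerivAt_charPos_time' hs.1 hx.1.le).hasDerivWithinAt).congr_deriv ?_
    have h1 := heq s (hI hs) _ (hmaps hs)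
    rw [charFoot_eq hs.1 (hmaps hs) hx rfl] at h1
    linear_combination h1
  have h1 := (convex_Icc 0 τ).norm_image_sub_le_of_norm_hasDerivWithin_le (C := 0) hd
    (fun s _ => by simp) (left_mem_Icc.2 hτT.1) (right_mem_Icc.2 hτT.1)
  rw [zero_mul, norm_le_zero_iff, sub_eq_zero, charPos_charFoot hm, charPos_zero_left] at h1
  have h2 : w τ m = u t m := by simp [hw, hτ]
  rw [← h2, h1]
  simp only [hw, sub_zero]
  exact h0 _ hx

/-! ### Regularity of the foot. -/

lemma charSlope_charFoot_pos {t m : ℝ} (ht : 0 ≤ t) (hm : m ∈ Ioc (0 : ℝ) 1) :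
    0 < charSlope t (charFoot t m) := hm.1.trans_le (le_charSlope_charFoot ht hm)

/-- Since the slope at the foot is positive, the implicit function theorem gives a local `C¹`
solution of `charPos t x = m`, and uniqueness in `(0, 1]` identifies it with the foot. -/
lemma contDiffOn_charFoot :
    ContDiffOn ℝ 1 (fun p : ℝ × ℝ => charFoot p.1 p.2) (Ici 0 ×ˢ Ioc 0 1) := by
  rintro ⟨t, m⟩ ⟨ht, hm⟩
  simp only [mem_Ici] at ht hm
  set x := charFoot t m with hx
  have hx01 := charFoot_mem (t := t) hm
  let f : (ℝ × ℝ) × ℝ → ℝ := fun q => charPos q.1.1 q.2 - q.1.2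
  have hf : ContDiff ℝ 1 f := by
    simp only [f, charPos]
    fun_prop
  have hfx : f ((t, m), x) = 0 := by simp [f, hx, charPos_charFoot hm]
  have hinv : (fderiv ℝ f ((t, m), x) ∘SL ContinuousLinearMap.inr ℝ (ℝ × ℝ) ℝ).IsInvertible := by
    have h1 : HasDerivAt (fun y : ℝ => f ((t, m), y)) (charSlope t x) x :=
      (hasDerivAt_charPos t x).sub_const m
    have h2 : HasDerivAt (fun y : ℝ => f ((t, m), y)) (fderiv ℝ f ((t, m), x) (0, 1)) x :=
      ((hf.differentiable one_ne_zero) ((t, m), x)).hasFDerivAt.comp_hasDerivAt x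
        ((hasDerivAt_const x (t, m)).prodMk (hasDerivAt_id x))
    have h3 := h1.unique h2
    refine ⟨ContinuousLinearEquiv.smulLeft
      (Units.mk0 (charSlope t x) (charSlope_charFoot_pos ht hm).ne'), ?_⟩
    ext
    simp [Units.smul_def, h3]
  have hfa : ContDiffAt ℝ 1 f ((t, m), x) := hf.contDiffAt
  set h := hfa.implicitFunction one_ne_zero hinv with hh
  have hC : ContDiffAt ℝ 1 h (t, m) := hfa.contDiffAt_implicitFunction one_ne_zero hinv
  have hself : h (t, m) = x := hfa.implicitFunction_apply_self one_ne_zero hinv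
  have hev : ∀ᶠ p in 𝓝 (t, m), f (p, h p) = f ((t, m), x) :=
    hfa.eventually_apply_implicitFunction one_ne_zero hinv
  have hpos : ∀ᶠ p in 𝓝 (t, m), 0 < h p :=
    hC.continuousAt (Ioi_mem_nhds (by rw [hself]; exact hx01.1))
  refine (hC.contDiffWithinAt (s := Ici 0 ×ˢ Ioc 0 1)).congr_of_eventuallyEq ?_ hself.symm
  filter_upwards [mem_nhdsWithin_of_mem_nhds hev, mem_nhdsWithin_of_mem_nhds hpos,
    self_mem_nhdsWithin] with p h1 h2 h3
  rw [hfx] at h1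
  have h4 : charPos p.1 (h p) = p.2 := sub_eq_zero.1 h1
  refine charFoot_eq h3.1 h3.2 ⟨h2, ?_⟩ h4
  -- A root larger than `1` is excluded since there `charPos > 1 ≥ m`.
  by_contra! h5
  have h6 : 0 < (h p - 1) * (1 + h p * p.1) ^ 2 := by
    have h7 : 0 ≤ p.1 := h3.1
    have : 0 < h p - 1 := by linarith
    positivity
  have h7 := h3.2.2
  rw [← h4] at h7
  unfold charPos at h7
  linarith

lemma contDiffOn_charVal_charFoot :
    ContDiffOn ℝ 1 (fun p : ℝ × ℝ => charVal p.1 (charFoot p.1 p.2)) (Ici 0 ×ˢ Ioc 0 1) := by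
  unfold charVal
  refine (contDiffOn_const.mul contDiffOn_charFoot).div
    (contDiffOn_const.add (contDiffOn_charFoot.mul contDiff_fst.contDiffOn)) ?_
  rintro ⟨t, m⟩ ⟨ht, hm⟩
  have h1 : 0 ≤ charFoot t m * t := mul_nonneg (charFoot_mem hm).1.le ht
  exact (by positivity : (1 + charFoot t m * t) ≠ 0)

lemma contDiffOn_charCost_charFoot :
    ContDiffOn ℝ 1 (fun p : ℝ × ℝ => charCost p.1 (charFoot p.1 p.2)) (Ici 0 ×ˢ Ioc 0 1) :=
  contDiffOn_charFoot.neg.add contDiffOn_charVal_charFoot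

lemma hasDerivWithinAt_charFoot {t m : ℝ} (ht : 0 ≤ t) (hm : m ∈ Ioc (0 : ℝ) 1) :
    HasDerivWithinAt (charFoot t) (1 / charSlope t (charFoot t m)) (Ioc 0 1) m := by
  have h1 : DifferentiableWithinAt ℝ (charFoot t) (Ioc 0 1) m :=
    (contDiffOn_charFoot.differentiableOn one_ne_zero (t, m) ⟨ht, hm⟩).comp (f := fun n => (t, n)) m
      ((differentiableWithinAt_const t).prodMk differentiableWithinAt_id) (fun n hn => ⟨ht, hn⟩)
  have h2 := (hasDerivAt_charPos t (charFoot t m)).comp_hasDerivWithinAt m h1.hasDerivWithinAt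
  have h3 : HasDerivWithinAt (charPos t ∘ charFoot t) 1 (Ioc 0 1) m :=
    (hasDerivWithinAt_id m _).congr (fun n hn => charPos_charFoot hn) (charPos_charFoot hm)
  have h4 := (uniqueDiffOn_Ioc 0 1 m hm).eq_deriv _ h2 h3
  have h5 := (charSlope_charFoot_pos ht hm).ne'
  refine h1.hasDerivWithinAt.congr_deriv ?_
  rw [eq_div_iff h5]
  linarith

lemma hasDerivWithinAt_charFoot_time {t m : ℝ} (ht : 0 ≤ t) (hm : m ∈ Ioc (0 : ℝ) 1) :
    HasDerivWithinAt (fun s => charFoot s m)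
      ((1 - m) * charVal t (charFoot t m) * (1 / charSlope t (charFoot t m))) (Ici 0) t := by
  have h1 : DifferentiableWithinAt ℝ (fun s => charFoot s m) (Ici 0) t :=
    (contDiffOn_charFoot.differentiableOn one_ne_zero (t, m) ⟨ht, hm⟩).comp (f := fun s => (s, m)) t
      (differentiableWithinAt_id.prodMk (differentiableWithinAt_const m)) (fun n hn => ⟨hn, hm⟩)
  set x := charFoot t m with hx
  set d := derivWithin (fun s => charFoot s m) (Ici 0) t
  have hd : HasDerivWithinAt (fun s => charFoot s m) d (Ici 0) t := h1.hasDerivWithinAt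
  have h2 : HasDerivWithinAt (fun s => charPos s (charFoot s m))
      (charSlope t x * d - 2 * x * (1 - x) * (1 + x * t)) (Ici 0) t := by
    have a1 := (hd.mul (hasDerivWithinAt_id t _)).const_add 1
    have a2 := ((hd.const_sub 1).mul (a1.pow 2)).const_sub 1
    refine a2.congr_deriv ?_
    simp [charSlope, ← hx]
    ring
  have h3 : HasDerivWithinAt (fun s => charPos s (charFoot s m)) 0 (Ici 0) t :=
    (hasDerivWithinAt_const t _ m).congr (fun n hn => charPos_charFoot hm) (charPos_charFoot hm)
  have h4 := (uniqueDiffOn_Ici 0 t ht).eq_deriv _ h2 h3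
  have h5 := (charSlope_charFoot_pos ht hm).ne'
  rw [← hx] at h5
  refine hd.congr_deriv ?_
  have h6 : (1 - m) * charVal t x = 2 * x * (1 - x) * (1 + x * t) := by
    have h7 : charPos t x = m := charPos_charFoot hm
    have h8 : 1 + x * t ≠ 0 := by
      have : 0 ≤ x * t := mul_nonneg (charFoot_mem hm).1.le ht
      positivity
    rw [← h7]
    unfold charPos charVal
    field_simp
    ring
  rw [h6]
  field_simp
  linarith

lemma hasDerivWithinAt_charVal_time {t x' : ℝ} {x : ℝ → ℝ} {S : Set ℝ} (ht : 0 ≤ t)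
    (hx0 : 0 ≤ x t) (hx : HasDerivWithinAt x x' S t) :
    HasDerivWithinAt (fun s => charVal s (x s))
      (2 / (1 + x t * t) ^ 2 * x' - charVal t (x t) ^ 2 / 2) S t := by
  have h0 : 1 + x t * t ≠ 0 := by positivity
  have h1 := (hx.const_mul 2).div ((hx.mul (hasDerivWithinAt_id t S)).const_add 1) (by simpa using h0)
  refine h1.congr_deriv ?_
  simp only [id, Pi.mul_apply]
  unfold charVal
  field_simp
  ring

lemma hasDerivAt_charVal {t x : ℝ} (ht : 0 ≤ t) (hx : 0 ≤ x) :
    HasDerivAt (charVal t) (2 / (1 + x * t) ^ 2) x := by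
  have h0 : 1 + x * t ≠ 0 := by positivity
  have h1 : HasDerivAt (fun x : ℝ => 1 + x * t) t x := by
    simpa using ((hasDerivAt_id x).mul_const t).const_add 1
  refine (((hasDerivAt_id x).const_mul 2).div h1 h0).congr_deriv ?_
  simp only [id, mul_one]
  field_simp
  ring

/-! ### Construction of the entropy solution and of the master solution. -/

/-- The function equal to `f t m` for `m > 0` and to `g t (-m)` for `m < 0`. -/
def glue (f g : ℝ → ℝ → ℝ) (t m : ℝ) : ℝ := if 0 < m then f t m else if m < 0 then g t (-m) else 0

lemma glue_of_pos {f g : ℝ → ℝ → ℝ} {t m : ℝ} (hm : 0 < m) : glue f g t m = f t m := if_pos hm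

lemma glue_neg (f g : ℝ → ℝ → ℝ) (t m : ℝ) : glue f g t (-m) = glue g f t m := by
  unfold glue
  rcases lt_trichotomy m 0 with h | rfl | h
  · simp [h, h.not_gt]
  · simp
  · simp [h, h.not_gt]

lemma glue_zero (f g : ℝ → ℝ → ℝ) (t : ℝ) : glue f g t 0 = 0 := by simp [glue]

lemma contDiffOn_glue {T : ℝ} {f g : ℝ → ℝ → ℝ}
    (hf : ContDiffOn ℝ 1 (fun p : ℝ × ℝ => f p.1 p.2) (Ici 0 ×ˢ Ioc 0 1))
    (hg : ContDiffOn ℝ 1 (fun p : ℝ × ℝ => g p.1 p.2) (Ici 0 ×ˢ Ioc 0 1)) :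
    ContDiffOn ℝ 1 (fun p : ℝ × ℝ => glue f g p.1 p.2) (Icc 0 T ×ˢ (Icc (-1) 1 \ {0})) := by
  have key : ∀ (f g : ℝ → ℝ → ℝ),
      ContDiffOn ℝ 1 (fun p : ℝ × ℝ => f p.1 p.2) (Ici 0 ×ˢ Ioc 0 1) →
      ∀ t ∈ Icc 0 T, ∀ m ∈ Ioc (0 : ℝ) 1, ContDiffWithinAt ℝ 1
        (fun p : ℝ × ℝ => glue f g p.1 p.2) (Icc 0 T ×ˢ (Icc (-1) 1 \ {0})) (t, m) := by
    intro f g hf t ht m hm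
    have hev : ∀ᶠ p : ℝ × ℝ in 𝓝 (t, m), 0 < p.2 :=
      continuousAt_snd (Ioi_mem_nhds hm.1)
    have h1 := hf (t, m) ⟨ht.1, hm⟩
    refine (h1.mono_of_mem_nhdsWithin (t := Icc 0 T ×ˢ (Icc (-1) 1 \ {0})) ?_).congr_of_eventuallyEq
      ?_ (glue_of_pos hm.1)
    · filter_upwards [mem_nhdsWithin_of_mem_nhds hev, self_mem_nhdsWithin] with p h2 h3
      exact ⟨h3.1.1, h2, h3.2.1.2⟩
    · filter_upwards [mem_nhdsWithin_of_mem_nhds hev] with p h2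
      exact glue_of_pos h2
  rintro ⟨t, m⟩ ⟨ht, hm, hm0⟩
  simp only [mem_singleton_iff] at ht hm hm0
  rcases lt_or_gt_of_ne hm0 with h | h
  · have h1 := key g f hg t ht (-m) ⟨by linarith, by linarith [hm.1]⟩
    have h2 := h1.comp (g := fun p : ℝ × ℝ => glue g f p.1 p.2) (f := fun p : ℝ × ℝ => (p.1, -p.2))
      (s := Icc 0 T ×ˢ (Icc (-1) 1 \ {0})) (t, m) (by fun_prop) (by
        rintro ⟨s, n⟩ ⟨hs, hn, hn0⟩
        exact ⟨hs, ⟨by linarith [hn.2], by linarith [hn.1]⟩, by simpa using hn0⟩)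
    refine h2.congr (fun p _ => ?_) ?_
    · simp [glue_neg]
    · simp [glue_neg]
  · exact key f g hf t ht m ⟨h, hm.2⟩

lemma hasDerivWithinAt_glue {f g : ℝ → ℝ → ℝ} {t m d : ℝ} (hm : m ∈ Ioc (0 : ℝ) 1)
    (hf : HasDerivWithinAt (f t) d (Ioc 0 1) m) :
    HasDerivWithinAt (glue f g t) d (Icc (-1) 1) m := by
  refine (hf.mono_of_mem_nhdsWithin (Ioc_mem_nhdsWithin_Icc hm)).congr_of_eventuallyEq ?_
    (glue_of_pos hm.1)
  filter_upwards [mem_nhdsWithin_of_mem_nhds (Ioi_mem_nhds hm.1)] with y hy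
  exact glue_of_pos hy

/-- The value `Z` on the right of the shock. -/
def valRight (t m : ℝ) : ℝ := charVal t (charFoot t m)

/-- The entropy solution. -/
def entropySol : ℝ → ℝ → ℝ := glue valRight fun t m => -valRight t m

lemma entropySol_neg (t m : ℝ) : entropySol t (-m) = -entropySol t m := by
  unfold entropySol
  rw [glue_neg]
  unfold glue
  split_ifs <;> simp

lemma valRight_hasDerivWithinAt {t m : ℝ} (ht : 0 ≤ t) (hm : m ∈ Ioc (0 : ℝ) 1) :
    HasDerivWithinAt (valRight t) (2 / (1 + charFoot t m * t) ^ 2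
      * (1 / charSlope t (charFoot t m))) (Ioc 0 1) m :=
  (hasDerivAt_charVal ht (charFoot_mem hm).1.le).comp_hasDerivWithinAt m
    (hasDerivWithinAt_charFoot ht hm)

lemma valRight_hasDerivWithinAt_time {t m : ℝ} (ht : 0 ≤ t) (hm : m ∈ Ioc (0 : ℝ) 1) :
    HasDerivWithinAt (fun s => valRight s m) (2 / (1 + charFoot t m * t) ^ 2
      * ((1 - m) * charVal t (charFoot t m) * (1 / charSlope t (charFoot t m)))
      - charVal t (charFoot t m) ^ 2 / 2) (Ici 0) t :=
  hasDerivWithinAt_charVal_time ht (charFoot_mem hm).1.le (hasDerivWithinAt_charFoot_time ht hm)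

lemma flux_neg_neg (m z : ℝ) : flux (-m) (-z) = flux m z := by
  unfold flux
  rw [abs_neg]
  ring

lemma isEntropySolution_entropySol {T : ℝ} (hT : 0 < T) :
    IsEntropySolution flux (fun m => 2 * m) T (fun _ => 0) entropySol where
  curve := contDiffOn_const
  smooth := (contDiffOn_glue contDiffOn_charVal_charFoot contDiffOn_charVal_charFoot.neg).mono
    fun p hp => ⟨hp.1, hp.2.1, hp.2.2⟩
  equation := by
    have key : ∀ t ∈ Icc 0 T, ∀ m ∈ Ioc (0 : ℝ) 1, ∃ a,
        HasDerivWithinAt (fun s => entropySol s m) a (Icc 0 T) t ∧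
        HasDerivWithinAt (fun y => flux y (entropySol t y)) (-a) (Icc (-1) 1) m := by
      intro t ht m hm
      have h1 := hasDerivWithinAt_glue (g := fun t m => -valRight t m) hm
        (valRight_hasDerivWithinAt ht.1 hm)
      have h2 := (valRight_hasDerivWithinAt_time ht.1 hm).mono (t := Ici 0) (s := Icc 0 T)
        Icc_subset_Ici_self
      refine ⟨_, h2.congr (fun s _ => glue_of_pos hm.1) (glue_of_pos hm.1),
        (hasDerivWithinAt_flux h1).congr_deriv ?_⟩
      have h3 : 0 ≤ charVal t (charFoot t m) := charVal_nonneg ht.1 (charFoot_mem hm).1.le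
      rw [glue_of_pos hm.1]
      unfold valRight
      rw [abs_of_nonneg h3]
      ring
    intro t ht m hm hm0
    have hu := uniqueDiffOn_Icc (show (-1 : ℝ) < 1 by norm_num) m hm
    rcases lt_or_gt_of_ne hm0 with h | h
    · obtain ⟨a, h1, h2⟩ := key t ht (-m) ⟨by linarith, by linarith [hm.1]⟩
      have h3 : HasDerivWithinAt (fun s => entropySol s m) (-a) (Icc 0 T) t := by
        refine h1.neg.congr_of_eventuallyEq (Eventually.of_forall fun s => ?_) ?_ <;>
        simp [entropySol_neg]
      have h4 : HasDerivWithinAt (fun y => flux y (entropySol t y)) a (Icc (-1) 1) m := by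
        have h5 : HasDerivWithinAt (fun y : ℝ => -y) (-1) (Icc (-1) 1) m := hasDerivWithinAt_neg m _
        have h6 := HasDerivWithinAt.scomp m h2 h5
          (fun y hy => ⟨by linarith [hy.2], by linarith [hy.1]⟩)
        refine (h6.congr_deriv (by simp)).congr_of_eventuallyEq
          (Eventually.of_forall fun y => ?_) ?_ <;>
        simp [entropySol_neg, flux_neg_neg]
      rw [h3.derivWithin (uniqueDiffOn_Icc hT t ht), h4.derivWithin hu]
      ring
    · obtain ⟨a, h1, h2⟩ := key t ht m ⟨h, hm.2⟩
      rw [h1.derivWithin (uniqueDiffOn_Icc hT t ht), h2.derivWithin hu]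
      ring
  initial := by
    have key : ∀ m ∈ Ioc (0 : ℝ) 1, entropySol 0 m = 2 * m := fun m hm => by
      rw [entropySol, glue_of_pos hm.1]
      simp [valRight, charVal, charFoot_zero_left hm]
    intro m hm
    rcases lt_trichotomy m 0 with h | rfl | h
    · have := key (-m) ⟨by linarith, by linarith [hm.1]⟩
      rw [entropySol_neg] at this
      linarith
    · simp [entropySol, glue_zero]
    · exact key m ⟨h, hm.2⟩
  shock := by
    intro t ht
    -- The one-sided limits exist because the solution is nonnegative and increasing on `(0, 1)` and
    -- odd. They are `-z` and `z`, and at `m = 0` the flux is `-z ^ 2 / 2`: its evenness makes the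
    -- shock stationary, its concavity gives the Lax condition.
    have hmono : MonotoneOn (entropySol t) (Ioo 0 1) := by
      intro m hm n hn hmn
      rw [entropySol, glue_of_pos hm.1, glue_of_pos hn.1]
      have h1 := charVal_lipschitz ht.1 (charFoot_mem (t := t) (Ioo_subset_Ioc_self hm)).1.le
        (charFoot_mono ht.1 (Ioo_subset_Ioc_self hm) (Ioo_subset_Ioc_self hn) hmn)
      unfold valRight
      linarith [h1.1]
    have hnn : ∀ y ∈ entropySol t '' Ioo 0 1, 0 ≤ y := by
      rintro _ ⟨m, hm, rfl⟩
      rw [entropySol, glue_of_pos hm.1]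
      exact charVal_nonneg ht.1 (charFoot_mem (Ioo_subset_Ioc_self hm)).1.le
    have hlim := hmono.tendsto_nhdsWithin_Ioo_right (nonempty_Ioo.2 zero_lt_one) ⟨0, hnn⟩
    set z := sInf (entropySol t '' Ioo 0 1)
    have hz : 0 ≤ z := Real.sInf_nonneg hnn
    refine ⟨-z, z, ?_, hlim, fun _ => ?_, fun c hc => ?_⟩
    · have h1 : Tendsto (fun m : ℝ => -entropySol t (-m)) (𝓝[<] 0) (𝓝 (-z)) := by
        refine (hlim.comp ?_).neg
        simpa using tendsto_neg_nhdsLT (a := (0 : ℝ))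
      refine h1.congr fun m => ?_
      rw [entropySol_neg, neg_neg]
    · simp [flux]
    · have e1 : min (-z) z = -z := min_eq_left (by linarith)
      have e2 : max (-z) z = z := max_eq_right (by linarith)
      rw [e1, e2] at hc
      have h1 : c - z ≠ 0 := by linarith [hc.2]
      have h2 : c - -z ≠ 0 := by linarith [hc.1]
      have h3 : (flux 0 c - flux 0 z) / (c - z) = -(c + z) / 2 := by
        unfold flux
        field_simp
        ring
      have h4 : (flux 0 c - flux 0 (-z)) / (c - -z) = -(c - z) / 2 := by
        unfold flux
        field_simp
        ring
      rw [h3, h4]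
      simp only [derivWithin_fun_const, Pi.zero_apply]
      constructor <;> linarith [hc.1, hc.2]

lemma stateVal_neg (x : ℤˣ) : stateVal (-x) = -stateVal x := by simp [stateVal]

lemma stateVal_one : stateVal 1 = 1 := by simp [stateVal]

/-- The value, in reversed time, of a player in the majority state. -/
def majorityCost (s m : ℝ) : ℝ := -charFoot s m

/-- The value, in reversed time, of a player in the minority state. -/
def minorityCost (s m : ℝ) : ℝ := charCost s (charFoot s m)

/-- The solution of the master equation that corresponds to `entropySol`. -/
def masterSol (T t : ℝ) (x : ℤˣ) (m : ℝ) : ℝ :=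
  if x = 1 then glue majorityCost minorityCost (T - t) m
  else glue minorityCost majorityCost (T - t) m

/-- Exchanging the names of the two states is a symmetry of the game; it reduces the equation to `m
> 0`. -/
lemma masterSol_neg (T t : ℝ) (x : ℤˣ) (m : ℝ) :
    masterSol T t (-x) (-m) = masterSol T t x m := by
  unfold masterSol
  rcases Int.units_eq_one_or x with rfl | rfl
  · rw [if_neg (by decide), if_pos rfl, glue_neg]
  · rw [if_pos (by decide), if_neg (by decide), glue_neg]

lemma measureDeriv_eq {U : ℝ → ℤˣ → ℝ → ℝ} {t m d : ℝ} {x : ℤˣ} (y : ℤˣ)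
    (h : HasDerivAt (U t x) d m) : measureDeriv U t x m y = -2 * stateVal y * d := by
  have h1 : HasDerivAt (fun s : ℝ => m - 2 * stateVal y * s) (-(2 * stateVal y)) 0 := by
    simpa using ((hasDerivAt_id (0 : ℝ)).const_mul (2 * stateVal y)).const_sub m
  have h2 : HasDerivAt (fun s : ℝ => U t x (m - 2 * stateVal y * s)) (d * -(2 * stateVal y)) 0 :=
    HasDerivAt.comp (h := fun s : ℝ => m - 2 * stateVal y * s) (h₂ := U t x) 0 (by simpa using h) h1
  unfold measureDeriv
  rw [h2.hasDerivWithinAt.derivWithin (uniqueDiffOn_Ici 0 0 self_mem_Ici)]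
  ring

lemma stateDiff_masterSol (T t m : ℝ) :
    stateDiff (masterSol T) t 1 m = entropySol (T - t) m := by
  have h : (-1 : ℤˣ) ≠ 1 := by decide
  simp only [stateDiff, masterSol, if_neg h, if_true, entropySol]
  unfold glue
  split_ifs
  · simp [minorityCost, majorityCost, charCost, valRight]
  · simp [minorityCost, majorityCost, charCost, valRight]
  · simp

lemma stateDiff_neg (U : ℝ → ℤˣ → ℝ → ℝ) (t : ℝ) (x : ℤˣ) (m : ℝ) :
    stateDiff U t (-x) m = -stateDiff U t x m := by
  simp [stateDiff]

/-- The backward equation for a value on the right of the shock, with running cost `c`. -/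
lemma master_of_transport {T : ℝ} {U : ℝ → ℤˣ → ℝ → ℝ} {F : ℝ → ℝ → ℝ} {t m a b c ζ : ℝ} {x : ℤˣ}
    (hT : 0 < T) (ht : t ∈ Icc 0 T) (hm : m ∈ Ioc (0 : ℝ) 1)
    (hU : ∀ s, ∀ n > 0, U s x n = F (T - s) n)
    (ha : HasDerivWithinAt (fun s => F s m) a (Ici 0) (T - t))
    (hb : HasDerivWithinAt (F (T - t)) b (Ioc 0 1) m)
    (hab : a = (1 - m) * ζ * b - c) (hζ : 0 ≤ ζ) (h1 : stateDiff U t 1 m = ζ)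
    (hc : (stateDiff U t x m)⁻ ^ 2 / 2 = c) :
    - derivWithin (fun s => U s x m) (Icc 0 T) t + (stateDiff U t x m)⁻ ^ 2 / 2
      - measureDeriv U t x m 1 * (stateDiff U t 1 m)⁻ * ((1 + m) / 2)
      - measureDeriv U t x m (-1) * (stateDiff U t (-1) m)⁻ * ((1 - m) / 2) = 0 := by
  have e1 : (stateDiff U t 1 m)⁻ = 0 := by rw [h1, negPart_eq_zero]; exact hζ
  have e2 : (stateDiff U t (-1) m)⁻ = ζ := by rw [stateDiff_neg, h1, negPart_neg_of_nonneg hζ]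
  have hd : HasDerivWithinAt (fun s => U s x m) (-a) (Icc 0 T) t := by
    simp only [hU _ m hm.1]
    exact HasDerivWithinAt.comp_time_reversal (ha.mono Icc_subset_Ici_self)
  rw [hd.derivWithin (uniqueDiffOn_Icc hT t ht), hc, e1, e2, hab]
  rcases hm.2.eq_or_lt with rfl | hm1
  · ring
  · have h2 : HasDerivAt (U t x) b m := by
      refine (hb.hasDerivAt (Ioc_mem_nhds hm.1 hm1)).congr_of_eventuallyEq ?_
      filter_upwards [Ioi_mem_nhds hm.1] with n hn
      exact hU t n hn
    rw [measureDeriv_eq (-1) h2, stateVal_neg, stateVal_one]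
    ring

lemma isMasterSolution_masterSol {T : ℝ} (hT : 0 < T) :
    IsMasterSolution T entropySol (masterSol T) where
  smooth := by
    have key : ∀ f : ℝ → ℝ → ℝ,
        ContDiffOn ℝ 1 (fun p : ℝ × ℝ => f p.1 p.2) (Icc 0 T ×ˢ (Icc (-1) 1 \ {0})) →
        ContDiffOn ℝ 1 (fun p : ℝ × ℝ => f (T - p.1) p.2) (Icc 0 T ×ˢ (Icc (-1) 1 \ {0})) := by
      intro f hf
      refine hf.comp (f := fun p : ℝ × ℝ => (T - p.1, p.2)) (by fun_prop) ?_
      rintro ⟨s, m⟩ ⟨hs, hm⟩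
      exact ⟨⟨by linarith [hs.2], by linarith [hs.1]⟩, hm⟩
    intro x
    unfold masterSol
    by_cases hx : x = 1
    · simp only [hx, if_true]
      exact key _ (contDiffOn_glue contDiffOn_charFoot.neg contDiffOn_charCost_charFoot)
    · simp only [hx, if_false]
      exact key _ (contDiffOn_glue contDiffOn_charCost_charFoot contDiffOn_charFoot.neg)
  equation := by
    have key : ∀ t ∈ Icc 0 T, ∀ m ∈ Ioc (0 : ℝ) 1, ∀ x,
        - derivWithin (fun s => masterSol T s x m) (Icc 0 T) t
          + (stateDiff (masterSol T) t x m)⁻ ^ 2 / 2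
          - measureDeriv (masterSol T) t x m 1 * (stateDiff (masterSol T) t 1 m)⁻ * ((1 + m) / 2)
          - measureDeriv (masterSol T) t x m (-1) * (stateDiff (masterSol T) t (-1) m)⁻
            * ((1 - m) / 2) = 0 := by
      intro t ht m hm x
      have hs : 0 ≤ T - t := by linarith [ht.2]
      have hζ : 0 ≤ valRight (T - t) m := charVal_nonneg hs (charFoot_mem hm).1.le
      have hst : stateDiff (masterSol T) t 1 m = valRight (T - t) m := by
        rw [stateDiff_masterSol, entropySol, glue_of_pos hm.1]
      have d1 := hasDerivWithinAt_charFoot hs hm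
      have d2 := hasDerivWithinAt_charFoot_time hs hm
      rcases Int.units_eq_one_or x with rfl | rfl
      · refine master_of_transport (F := majorityCost) (c := 0) hT ht hm (fun s n hn => ?_)
          d2.neg d1.neg ?_ hζ hst ?_
        · rw [masterSol, if_pos rfl, glue_of_pos hn]
        · unfold valRight
          ring
        · rw [hst, negPart_eq_zero.2 hζ]
          norm_num
      · refine master_of_transport (F := minorityCost) (c := valRight (T - t) m ^ 2 / 2) hT ht hm
          (fun s n hn => ?_) (d2.neg.add (valRight_hasDerivWithinAt_time hs hm))
          (d1.neg.add (valRight_hasDerivWithinAt hs hm)) ?_ hζ hst ?_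
        · rw [masterSol, if_neg (by decide), glue_of_pos hn]
        · unfold valRight
          ring
        · rw [stateDiff_neg, hst, negPart_neg_of_nonneg hζ]
    intro t ht m hm hm0 x
    rcases lt_or_gt_of_ne hm0 with h | h
    · have h1 := key t ht (-m) ⟨by linarith, by linarith [hm.1]⟩ (-x)
      have e1 : ∀ s y n, masterSol T s y n = masterSol T s (-y) (-n) := fun s y n =>
        (masterSol_neg T s y n).symm
      have e2 : ∀ y, stateDiff (masterSol T) t (-y) (-m) = stateDiff (masterSol T) t y m :=
        fun y => by simp only [stateDiff, masterSol_neg]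
      have e3 : ∀ y, measureDeriv (masterSol T) t (-x) (-m) (-y)
          = measureDeriv (masterSol T) t x m y := fun y => by
        unfold measureDeriv
        congr 1
        funext s
        rw [← masterSol_neg, neg_neg, stateVal_neg]
        congr 1
        ring
      have e4 := e2 (-1)
      have e5 := e3 (-1)
      rw [neg_neg] at e4 e5
      simp only [masterSol_neg] at h1
      rw [e2 x, e3 1, e4, e5, e2 1] at h1
      linear_combination h1
    · exact key t ht m ⟨h, hm.2⟩ x
  terminal := by
    have key : ∀ m ∈ Ioc (0 : ℝ) 1, ∀ x, masterSol T T x m = -m * stateVal x := by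
      intro m hm x
      unfold masterSol
      rcases Int.units_eq_one_or x with rfl | rfl
      · rw [if_pos rfl, glue_of_pos hm.1]
        simp [majorityCost, charFoot_zero_left hm, stateVal]
      · rw [if_neg (by decide), glue_of_pos hm.1]
        simp [minorityCost, charCost, charVal, charFoot_zero_left hm, stateVal]
        ring
    intro m hm x
    rcases lt_trichotomy m 0 with h | rfl | h
    · have := key (-m) ⟨by linarith, by linarith [hm.1]⟩ (-x)
      rw [masterSol_neg, stateVal_neg] at this
      linarith
    · simp [masterSol, glue_zero]
    · exact key m ⟨h, hm.2⟩ x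
  increment := fun t _ m _ => stateDiff_masterSol T t m

/-! ### Every solution is given by the characteristics off the shock. -/

/-- Away from the shock the entropy solution is unique. -/
lemma IsEntropySolution.eq_valRight {T : ℝ} (hT : 0 < T) {Z : ℝ → ℝ → ℝ}
    (hZ : IsEntropySolution flux (fun m => 2 * m) T (fun _ => 0) Z) {t m : ℝ} (ht : t ∈ Icc 0 T)
    (hm : m ∈ Ioc (0 : ℝ) 1) : Z t m = valRight t m ∧ Z t (-m) = -valRight t m := by
  constructor
  · refine eq_charVal_of_conservationLaw hT (hZ.smooth.mono ?_) (fun t ht m hm => ?_)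
      (fun m hm => ?_) ht hm
    · rintro p ⟨h1, h2⟩
      exact ⟨h1, ⟨by linarith [h2.1], h2.2⟩, h2.1.ne'⟩
    · exact hZ.equation t ht m ⟨by linarith [hm.1], hm.2⟩ hm.1.ne'
    · exact hZ.initial m ⟨by linarith [hm.1], hm.2⟩
  · suffices h : -Z t (-m) = valRight t m by linarith
    refine eq_charVal_of_conservationLaw hT (Z := fun t m => -Z t (-m)) ?_ (fun t ht m hm => ?_)
      (fun m hm => ?_) ht hm
    · refine ContDiffOn.neg (hZ.smooth.comp (f := fun p : ℝ × ℝ => (p.1, -p.2)) (by fun_prop) ?_)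
      rintro p ⟨h1, h2⟩
      exact ⟨h1, ⟨by linarith [h2.2], by linarith [h2.1]⟩, (neg_neg_of_pos h2.1).ne⟩
    · have h1 := hZ.equation t ht (-m) ⟨by linarith [hm.2], by linarith [hm.1]⟩
        (neg_neg_of_pos hm.1).ne
      have h2 : (fun y => flux y (-Z t (-y))) = fun y => (fun y => flux y (Z t y)) (-y) := by
        funext y
        have := flux_neg_neg (-y) (Z t (-y))
        rwa [neg_neg] at this
      have h3 : -Icc (-1 : ℝ) 1 = Icc (-1) 1 := by simp
      rw [h2, derivWithin_comp_neg (fun y => flux y (Z t y)), h3]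
      have h4 : derivWithin (fun s => -Z s (-m)) (Icc 0 T) t
          = -derivWithin (fun s => Z s (-m)) (Icc 0 T) t := derivWithin.fun_neg
      rw [h4]
      linarith
    · have := hZ.initial (-m) ⟨by linarith [hm.2], by linarith [hm.1]⟩
      simp only [this]
      ring

/-- Away from the shock the solution of the master equation is given by the characteristics. -/
lemma IsMasterSolution.eq_cost {T : ℝ} (hT : 0 < T) {Z : ℝ → ℝ → ℝ} {U : ℝ → ℤˣ → ℝ → ℝ}
    (hZ : IsEntropySolution flux (fun m => 2 * m) T (fun _ => 0) Z) (hU : IsMasterSolution T Z U)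
    {t m : ℝ} (ht : t ∈ Icc 0 T) (hm : m ∈ Ioc (0 : ℝ) 1) :
    U t 1 m = majorityCost (T - t) m ∧ U t 1 (-m) = minorityCost (T - t) m := by
  have hflip : ∀ s ∈ Icc 0 T, T - s ∈ Icc 0 T := fun s hs =>
    ⟨by linarith [hs.2], by linarith [hs.1]⟩
  have hinc : ∀ t ∈ Icc 0 T, ∀ m ∈ Ioc (0 : ℝ) 1, stateDiff U t 1 m = valRight (T - t) m ∧
      stateDiff U t 1 (-m) = -valRight (T - t) m := fun t ht m hm => by
    have := hZ.eq_valRight hT (hflip t ht) hm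
    rw [hU.increment t ht m ⟨by linarith [hm.1], hm.2⟩,
      hU.increment t ht (-m) ⟨by linarith [hm.2], by linarith [hm.1]⟩]
    exact this
  have hnn : ∀ t ∈ Icc 0 T, ∀ m ∈ Ioc (0 : ℝ) 1, 0 ≤ valRight (T - t) m := fun t ht m hm =>
    charVal_nonneg (hflip t ht).1 (charFoot_mem hm).1.le
  constructor
  · refine eq_neg_charFoot_of_transport hT (u := fun t m => U t 1 m) ((hU.smooth 1).mono ?_)
      (fun t ht m hm => ?_) (fun m hm => ?_) ht hm
    · rintro p ⟨h1, h2⟩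
      exact ⟨h1, ⟨by linarith [h2.1], h2.2⟩, h2.1.ne'⟩
    · have h1 := hU.equation t ht m ⟨by linarith [hm.1], hm.2⟩ hm.1.ne' 1
      have h2 := hnn t ht m hm
      rw [stateDiff_neg, (hinc t ht m hm).1, negPart_eq_zero.2 h2, negPart_neg_of_nonneg h2] at h1
      have h3 : measureDeriv U t 1 m (-1) = derivWithin (fun s => U t 1 (m + 2 * s)) (Ici 0) 0 := by
        simp [measureDeriv, stateVal]
      rw [h3] at h1
      unfold valRight at h1
      linear_combination h1
    · rw [hU.terminal m ⟨by linarith [hm.1], hm.2⟩, stateVal_one, mul_one]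
  · have h0 : U t (-1) (-m) = -charFoot (T - t) m := by
      refine eq_neg_charFoot_of_transport hT (u := fun t m => U t (-1) (-m)) ?_
        (fun t ht m hm => ?_) (fun m hm => ?_) ht hm
      · refine (hU.smooth (-1)).comp (f := fun p : ℝ × ℝ => (p.1, -p.2)) (by fun_prop) ?_
        rintro p ⟨h1, h2⟩
        exact ⟨h1, ⟨by linarith [h2.2], by linarith [h2.1]⟩, (neg_neg_of_pos h2.1).ne⟩
      · have h1 := hU.equation t ht (-m) ⟨by linarith [hm.2], by linarith [hm.1]⟩
          (neg_neg_of_pos hm.1).ne (-1)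
        have h2 := hnn t ht m hm
        rw [stateDiff_neg, (hinc t ht m hm).2, neg_neg, negPart_eq_zero.2 h2,
          negPart_neg_of_nonneg h2] at h1
        have h3 : measureDeriv U t (-1) (-m) 1
            = derivWithin (fun s => U t (-1) (-(m + 2 * s))) (Ici 0) 0 := by
          unfold measureDeriv
          congr 1
          funext s
          rw [stateVal_one]
          congr 1
          ring
        rw [h3] at h1
        unfold valRight at h1
        linear_combination h1
      · rw [hU.terminal (-m) ⟨by linarith [hm.2], by linarith [hm.1]⟩, stateVal_neg, stateVal_one]
        ring
    have h1 := (hinc t ht m hm).2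
    unfold stateDiff at h1
    rw [h0] at h1
    unfold minorityCost charCost
    unfold valRight at h1
    linarith

/-! ### Consistency of the scheme and the estimate. -/

lemma charFoot_increment {s m h δ : ℝ} (hs : 0 ≤ s) (hδ : 0 < δ) (hm : δ ≤ m)
    (hh : 0 < h) (hmh : m + h ≤ 1) :
    0 ≤ charFoot s (m + h) - charFoot s m ∧ charFoot s (m + h) - charFoot s m ≤ h / δ := by
  have hm1 : m ∈ Ioc (0 : ℝ) 1 := ⟨by linarith, by linarith⟩
  have hm2 : m + h ∈ Ioc (0 : ℝ) 1 := ⟨by linarith, by linarith⟩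
  have h1 := charFoot_mono hs hm1 hm2 (by linarith)
  have h2 := charFoot_lipschitz hs hm1 hm2 (by linarith)
  refine ⟨by linarith, ?_⟩
  rw [le_div_iff₀ hδ]
  have h3 : 0 ≤ s * charFoot s m := mul_nonneg hs (charFoot_mem hm1).1.le
  have h4 : 0 ≤ charFoot s (m + h) - charFoot s m := by linarith
  nlinarith

/-- The error is the quadratic remainder of `charPos`, at most a constant times `(h / δ) ^ 2`,
divided by `h` and by a slope at least `δ`. -/
lemma charFoot_taylor {s T m h δ : ℝ} (hs : 0 ≤ s) (hsT : s ≤ T) (hδ : 0 < δ) (hm : δ ≤ m)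
    (hh : 0 < h) (hmh : m + h ≤ 1) :
    |(charFoot s (m + h) - charFoot s m) / h - 1 / charSlope s (charFoot s m)|
      ≤ (2 * T + 2 * T ^ 2) / δ ^ 3 * h := by
  have hm1 : m ∈ Ioc (0 : ℝ) 1 := ⟨by linarith, by linarith⟩
  have hm2 : m + h ∈ Ioc (0 : ℝ) 1 := ⟨by linarith, by linarith⟩
  obtain ⟨h1, h2⟩ := charFoot_increment hs hδ hm hh hmh
  have hx := charFoot_mem (t := s) hm1
  have hy := charFoot_mem (t := s) hm2
  have h3 := charPos_taylor hs hsT hx.1.le hx.2 hy.1.le hy.2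
  rw [charPos_charFoot hm1, charPos_charFoot hm2] at h3
  have hσ : δ ≤ charSlope s (charFoot s m) := hm.trans (le_charSlope_charFoot hs hm1)
  set σ := charSlope s (charFoot s m)
  set d := charFoot s (m + h) - charFoot s m
  have hσ0 : 0 < σ := hδ.trans_le hσ
  have hT : 0 ≤ T := hs.trans hsT
  have e : d / h - 1 / σ = -(m + h - m - σ * d) / (h * σ) := by
    field_simp
    ring
  rw [e, abs_div, abs_neg, abs_of_pos (mul_pos hh hσ0), div_le_iff₀ (mul_pos hh hσ0)]
  calc _ ≤ (2 * T + 2 * T ^ 2) * d ^ 2 := h3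
    _ ≤ (2 * T + 2 * T ^ 2) * (h / δ) ^ 2 := by gcongr
    _ = (2 * T + 2 * T ^ 2) / δ ^ 3 * h * (h * δ) := by field_simp
    _ ≤ _ := by gcongr

/-- The constant in the consistency error of the reduced system. -/
def consistencyConst (T δ : ℝ) : ℝ := (2 + 4 * T) / δ ^ 2 + 2 * ((2 * T + 2 * T ^ 2) / δ ^ 3)

lemma charVal_mem {s m : ℝ} (hs : 0 ≤ s) (hm : m ∈ Ioc (0 : ℝ) 1) :
    0 ≤ charVal s (charFoot s m) ∧ charVal s (charFoot s m) ≤ 2 := by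
  have hx := charFoot_mem (t := s) hm
  exact ⟨charVal_nonneg hs hx.1.le, by linarith [charVal_le hs hx.1.le, hx.2]⟩

/-- The transport equation is replaced by a forward difference with the rate taken at `m + h`, as in
`deriv_upper`. Two errors of order `h` arise: the shift of `Z` and the difference quotient of the
foot. -/
lemma majority_consistency {s T m h δ : ℝ} (hs : 0 ≤ s) (hsT : s ≤ T) (hδ : 0 < δ) (hm : δ ≤ m)
    (hh : 0 < h) (hmh : m + h ≤ 1) :
    |-((1 - m) * charVal s (charFoot s m) * (1 / charSlope s (charFoot s m)))
      - (1 - m) / h * charVal s (charFoot s (m + h)) * (majorityCost s (m + h) - majorityCost s m)|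
      ≤ consistencyConst T δ * h := by
  have hm1 : m ∈ Ioc (0 : ℝ) 1 := ⟨by linarith, by linarith⟩
  have hm2 : m + h ∈ Ioc (0 : ℝ) 1 := ⟨by linarith, by linarith⟩
  obtain ⟨h1, h2⟩ := charFoot_increment hs hδ hm hh hmh
  have h3 := charFoot_taylor hs hsT hδ hm hh hmh
  obtain ⟨h4, h5⟩ := charVal_lipschitz hs (charFoot_mem (t := s) hm1).1.le (sub_nonneg.1 h1)
  obtain ⟨h6, h7⟩ := charVal_mem hs hm1
  unfold majorityCost
  have hT : 0 ≤ T := hs.trans hsT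
  set σ := charSlope s (charFoot s m)
  set ζ := charVal s (charFoot s m)
  set ζ' := charVal s (charFoot s (m + h))
  set d := charFoot s (m + h) - charFoot s m with hd
  have e : -((1 - m) * ζ * (1 / σ)) - (1 - m) / h * ζ' * (-charFoot s (m + h) - -charFoot s m)
      = (1 - m) * ((ζ' - ζ) * (d / h) + ζ * (d / h - 1 / σ)) := by
    rw [hd]
    ring
  have hdh : 0 ≤ d / h := by positivity
  have h8 : d / h ≤ 1 / δ := by
    rw [div_le_iff₀ hh]
    calc d ≤ h / δ := h2
      _ = _ := by ring
  have h9 : (ζ' - ζ) * (d / h) ≤ 2 * (h / δ) * (1 / δ) := by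
    have : ζ' - ζ ≤ 2 * (h / δ) := by linarith
    gcongr
  have h10 : |ζ * (d / h - 1 / σ)| ≤ 2 * ((2 * T + 2 * T ^ 2) / δ ^ 3 * h) := by
    rw [abs_mul, abs_of_nonneg h6]
    gcongr
  have h11 : 0 ≤ 1 - m := by linarith [hm1.2]
  -- Slack, so that this bound and the one for the minority, where `4 T / δ ^ 2` arises, share one
  -- constant.
  have h12 : 0 ≤ 4 * T / δ ^ 2 * h := by positivity
  rw [e, abs_mul, abs_of_nonneg h11]
  calc _ ≤ 1 * |(ζ' - ζ) * (d / h) + ζ * (d / h - 1 / σ)| := by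
        gcongr
        linarith [hm1.1]
    _ ≤ |(ζ' - ζ) * (d / h)| + |ζ * (d / h - 1 / σ)| := by rw [one_mul]; exact abs_add_le _ _
    _ ≤ 2 * (h / δ) * (1 / δ) + 2 * ((2 * T + 2 * T ^ 2) / δ ^ 3 * h) := by
        rw [abs_of_nonneg (mul_nonneg h4 hdh)]
        exact add_le_add h9 h10
    _ ≤ 2 * (h / δ) * (1 / δ) + 2 * ((2 * T + 2 * T ^ 2) / δ ^ 3 * h) + 4 * T / δ ^ 2 * h := by
        linarith
    _ = _ := by
        unfold consistencyConst
        field_simp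
        ring

lemma minority_consistency {s T m h δ : ℝ} (hs : 0 ≤ s) (hsT : s ≤ T) (hδ : 0 < δ) (hm : δ ≤ m)
    (hh : 0 < h) (hmh : m + h ≤ 1) :
    |(-1 + 2 / (1 + charFoot s m * s) ^ 2)
        * ((1 - m) * charVal s (charFoot s m) * (1 / charSlope s (charFoot s m)))
      - (1 - m) / h * charVal s (charFoot s m) * (minorityCost s (m + h) - minorityCost s m)|
      ≤ consistencyConst T δ * h := by
  have hm1 : m ∈ Ioc (0 : ℝ) 1 := ⟨by linarith, by linarith⟩
  have hm2 : m + h ∈ Ioc (0 : ℝ) 1 := ⟨by linarith, by linarith⟩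
  obtain ⟨h1, h2⟩ := charFoot_increment hs hδ hm hh hmh
  have h3 := charFoot_taylor hs hsT hδ hm hh hmh
  have hx0 := (charFoot_mem (t := s) hm1).1.le
  have h4 := charCost_taylor hs hsT hx0 (charFoot_mem (t := s) hm2).1.le
  obtain ⟨h6, h7⟩ := charVal_mem hs hm1
  unfold minorityCost
  have hT : 0 ≤ T := hs.trans hsT
  have hκ : |-1 + 2 / (1 + charFoot s m * s) ^ 2| ≤ 1 := by
    have h5 : 1 ≤ (1 + charFoot s m * s) ^ 2 := one_le_pow₀ (by nlinarith [mul_nonneg hx0 hs])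
    have h8 : 2 / (1 + charFoot s m * s) ^ 2 ≤ 2 := div_le_self (by norm_num) h5
    have h9 : 0 ≤ 2 / (1 + charFoot s m * s) ^ 2 := by positivity
    rw [abs_le]
    constructor <;> linarith
  set κ := -1 + 2 / (1 + charFoot s m * s) ^ 2
  set σ := charSlope s (charFoot s m)
  set ζ := charVal s (charFoot s m)
  set w := charCost s (charFoot s (m + h)) - charCost s (charFoot s m)
  set d := charFoot s (m + h) - charFoot s m with hd
  have e : κ * ((1 - m) * ζ * (1 / σ)) - (1 - m) / h * ζ * w
      = (1 - m) * ζ * (-(κ * (d / h - 1 / σ)) - (w - κ * d) / h) := by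
    ring
  have h8 : |κ * (d / h - 1 / σ)| ≤ 1 * ((2 * T + 2 * T ^ 2) / δ ^ 3 * h) := by
    rw [abs_mul]
    gcongr
  have h9 : |(w - κ * d) / h| ≤ 2 * T * (h / δ) ^ 2 / h := by
    rw [abs_div, abs_of_pos hh]
    refine div_le_div_of_nonneg_right (h4.trans ?_) hh.le
    gcongr
  have h10 : |(1 - m) * ζ| ≤ 1 * 2 := by
    rw [abs_mul, abs_of_nonneg h6, abs_of_nonneg (by linarith [hm1.2])]
    have : 1 - m ≤ 1 := by linarith [hm1.1]
    gcongr
  have h11 : 0 ≤ 2 / δ ^ 2 * h := by positivity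
  rw [e, abs_mul]
  calc _ ≤ 1 * 2 * |-(κ * (d / h - 1 / σ)) - (w - κ * d) / h| := by gcongr
    _ ≤ 1 * 2 * (|-(κ * (d / h - 1 / σ))| + |(w - κ * d) / h|) := by
        gcongr
        exact abs_sub _ _
    _ ≤ 1 * 2 * (1 * ((2 * T + 2 * T ^ 2) / δ ^ 3 * h) + 2 * T * (h / δ) ^ 2 / h) := by
        rw [abs_neg]
        gcongr
    _ ≤ 1 * 2 * (1 * ((2 * T + 2 * T ^ 2) / δ ^ 3 * h) + 2 * T * (h / δ) ^ 2 / h)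
        + 2 / δ ^ 2 * h := by linarith
    _ = _ := by
        unfold consistencyConst
        field_simp
        ring

/-- The constant in the estimate of the values. -/
def valueConst (T ε : ℝ) : ℝ :=
  2 / ε + 2 * consistencyConst T (2 * ε) * Real.exp ((2 * (1 / ε) + 5) * T)

lemma consistencyConst_nonneg {T δ : ℝ} (hT : 0 ≤ T) (hδ : 0 < δ) : 0 ≤ consistencyConst T δ := by
  unfold consistencyConst
  positivity

lemma tendsto_valueConst {T : ℝ} (hT : 0 ≤ T) : Tendsto (valueConst T) (𝓝[>] 0) atTop := by
  have h1 : Tendsto (fun ε : ℝ => 2 / ε) (𝓝[>] 0) atTop := by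
    simpa [div_eq_mul_inv] using tendsto_inv_nhdsGT_zero.const_mul_atTop (two_pos (α := ℝ))
  refine tendsto_atTop_mono' _ ?_ h1
  filter_upwards [self_mem_nhdsWithin] with ε hε
  have hε : 0 < ε := hε
  have := consistencyConst_nonneg hT (show 0 < 2 * ε by linarith)
  unfold valueConst
  have : 0 ≤ 2 * consistencyConst T (2 * ε) * Real.exp ((2 * (1 / ε) + 5) * T) := by positivity
  linarith

/-- The comparison theorem is applied with `δ = 2 ε` and step `2 / N` in the mean: `N` times an
increment of the foot is at most `N (2 / N) / (2 ε) = 1 / ε`, which is `A`, and the consistency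
error gives `R`. -/
lemma IsGridValue.abs_sub_cost_le {T : ℝ} (hT : 0 < T) {N : ℕ} (hN : 1 ≤ N) {v : ℕ → ℝ → ℝ}
    (hv : IsGridValue T N v) {ε : ℝ} (hε : 0 < ε) {j : ℕ} (hj : j ≤ N)
    (hjε : (1 / 2 + ε) * N ≤ j) {s : ℝ} (hs : s ∈ Icc 0 T) :
    |v j s - majorityCost s (2 * j / N - 1)| ≤ valueConst T ε / N ∧
    |v (N - j) s - minorityCost s (2 * j / N - 1)| ≤ valueConst T ε / N := by
  have hN0 : (0 : ℝ) < N := by exact_mod_cast hN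
  have hpos : ∀ k : ℕ, k ≤ N → (1 / 2 + ε) * N ≤ k →
      2 * ε ≤ 2 * (k : ℝ) / N - 1 ∧ 2 * (k : ℝ) / N - 1 ∈ Ioc (0 : ℝ) 1 := by
    intro k hk h
    have h1 : 2 * ε ≤ 2 * (k : ℝ) / N - 1 := by
      have : 1 + 2 * ε ≤ 2 * (k : ℝ) / N := by
        rw [le_div_iff₀ hN0]
        linarith
      linarith
    exact ⟨h1, by linarith, by linarith [(initial_mem hk).1]⟩
  have hC := consistencyConst_nonneg hT.le (show 0 < 2 * ε by linarith)
  have hE : 0 ≤ 2 * consistencyConst T (2 * ε) * Real.exp ((2 * (1 / ε) + 5) * T) := by positivity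
  -- For `ε N < 1` the bound exceeds `2` through the summand `2 / ε`, while all values lie in `[-1,
  -- 1]`. Otherwise `k₀ ≥ N / 2 + 1`, so `k₀ - 1` is still in the upper half, as the comparison
  -- requires.
  rcases lt_or_ge (ε * N) 1 with hεN | hεN
  · have h1 : 2 ≤ valueConst T ε / N := by
      rw [le_div_iff₀ hN0]
      have : 2 * N ≤ 2 / ε := by
        rw [le_div_iff₀ hε]
        linarith
      unfold valueConst
      linarith
    have hm := (hpos j hj hjε).2
    have hx := charFoot_mem (t := s) hm
    have h2 := abs_le.1 (abs_charCost_le hs.1 ⟨hx.1.le, hx.2⟩)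
    have h3 := abs_le.1 (hv.abs_le_one j hj s hs)
    have h4 := abs_le.1 (hv.abs_le_one (N - j) (by omega) s hs)
    unfold majorityCost minorityCost
    rw [abs_le, abs_le]
    refine ⟨⟨?_, ?_⟩, ?_, ?_⟩ <;> linarith [hx.1, hx.2]
  set k₀ := ⌈(1 / 2 + ε) * N⌉₊ with hk₀
  have hle : ∀ k : ℕ, k₀ ≤ k → (1 / 2 + ε) * N ≤ k := fun k hk => Nat.ceil_le.1 hk
  have hk₀r : (1 / 2 + ε) * N ≤ k₀ := hle k₀ le_rfl
  have hk₀N : N + 2 ≤ 2 * k₀ := by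
    have : (N : ℝ) + 2 ≤ 2 * k₀ := by linarith
    exact_mod_cast this
  set μ : ℕ → ℝ := fun k => 2 * (k : ℝ) / N - 1 with hμ
  have hμs : ∀ k : ℕ, μ (k + 1) = μ k + 2 / N := fun k => by
    simp only [hμ]
    push_cast
    ring
  have hcoef : ∀ k ≤ N, ((N - k : ℕ) : ℝ) = (1 - μ k) / (2 / N) := fun k hk => by
    rw [Nat.cast_sub hk]
    simp only [hμ]
    field_simp
    ring
  have hstep : ∀ k < N, k₀ ≤ k → 2 * ε ≤ μ k ∧ μ k + 2 / N ≤ 1 := fun k hk hk' => by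
    refine ⟨(hpos k hk.le (hle k hk')).1, ?_⟩
    rw [← hμs]
    exact (hpos (k + 1) hk (hle _ (by omega))).2.2
  have h2N : (0 : ℝ) < 2 / N := by positivity
  have hdiff : ∀ s m, minorityCost s m - majorityCost s m = charVal s (charFoot s m) := fun s m => by
    unfold minorityCost majorityCost charCost
    ring
  have hA : ∀ k < N, k₀ ≤ k → ∀ s ∈ Icc 0 T,
      N * (charFoot s (μ (k + 1)) - charFoot s (μ k)) ≤ 1 / ε := by
    intro k hk hk' s hs
    obtain ⟨h1, h2⟩ := hstep k hk hk'
    rw [hμs]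
    have h3 := (charFoot_increment hs.1 (by linarith) h1 h2N h2).2
    calc _ ≤ N * (2 / N / (2 * ε)) := by gcongr
      _ = 1 / ε := by field_simp
  have hmono : ∀ k < N, k₀ ≤ k → ∀ s ∈ Icc 0 T, charFoot s (μ k) ≤ charFoot s (μ (k + 1)) := by
    intro k hk hk' s hs
    obtain ⟨h1, h2⟩ := hstep k hk hk'
    rw [hμs]
    exact sub_nonneg.1 (charFoot_increment hs.1 (by linarith) h1 h2N h2).1
  have key := hv.abs_sub_le (p := fun k s => majorityCost s (μ k))
    (q := fun k s => minorityCost s (μ k)) (k₀ := k₀) (by omega) (by omega) (A := 1 / ε)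
    (R := consistencyConst T (2 * ε) * (2 / N)) (by positivity) (by positivity)
    (fun k hk hk' => by
      rw [hv.initial k hk]
      simp only [majorityCost, charFoot_zero_left (hpos k hk (hle k hk')).2, hμ]
      ring)
    (fun k hk hk' => by
      rw [hv.initial (N - k) (by omega), Nat.cast_sub hk]
      simp only [minorityCost, charCost, charVal, charFoot_zero_left (hpos k hk (hle k hk')).2, hμ,
        mul_zero, add_zero, div_one]
      field_simp
      ring)
    (fun k hk hk' s hs => by
      obtain ⟨h1, h2⟩ := charVal_mem hs.1 (hpos k hk (hle k hk')).2
      simp only [hdiff]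
      rw [abs_of_nonneg h1]
      exact h2)
    (fun k hk hk' s hs =>
      ((hasDerivWithinAt_charFoot_time hs.1 (hpos k hk (hle k hk')).2).mono
        Icc_subset_Ici_self).neg)
    (fun k hk hk' s hs =>
      ((hasDerivWithinAt_charFoot_time hs.1 (hpos k hk (hle k hk')).2).mono
        Icc_subset_Ici_self).neg.add
      ((valRight_hasDerivWithinAt_time hs.1 (hpos k hk (hle k hk')).2).mono Icc_subset_Ici_self))
    (fun k hk hk' s hs => by
      have h1 := hA k hk hk' s hs
      have h2 := hmono k hk hk' s hs
      simp only [majorityCost]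
      rw [neg_sub_neg, abs_sub_comm, abs_of_nonneg (by linarith)]
      exact h1)
    (fun k hk hk' s hs => by
      have h1 := hA k hk hk' s hs
      have h2 := hmono k hk hk' s hs
      have h3 := abs_charCost_sub_le hs.1 (charFoot_mem (t := s) (hpos k hk.le (hle k hk')).2).1.le h2
      refine le_trans ?_ h1
      exact mul_le_mul_of_nonneg_left h3 hN0.le)
    (fun k hk hk' s hs => by
      rcases hk.eq_or_lt with rfl | hk
      · have : μ k = 1 := by
          simp only [hμ]
          field_simp
          ring
        have h1 : 2 * (k : ℝ) / k - 1 = 1 := this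
        simp [h1]
        positivity
      · obtain ⟨h1, h2⟩ := hstep k hk hk'
        simp only [hdiff]
        rw [hμs, hcoef k hk.le]
        exact majority_consistency hs.1 hs.2 (by linarith) h1 h2N h2)
    (fun k hk hk' s hs => by
      rcases hk.eq_or_lt with rfl | hk
      · have : μ k = 1 := by
          simp only [hμ]
          field_simp
          ring
        have h1 : 2 * (k : ℝ) / k - 1 = 1 := this
        simp only [hdiff]
        simp [this, h1]
        positivity
      · obtain ⟨h1, h2⟩ := hstep k hk hk'
        simp only [hdiff]
        rw [hμs, hcoef k hk.le]
        have h3 := minority_consistency hs.1 hs.2 (by linarith) h1 h2N h2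
        refine le_trans (le_of_eq ?_) h3
        congr 1
        ring)
  have h1 := key j hj (Nat.ceil_le.2 hjε) s hs
  have h2 : consistencyConst T (2 * ε) * (2 / N) * Real.exp ((2 * (1 / ε) + 5) * T)
      ≤ valueConst T ε / N := by
    rw [le_div_iff₀ hN0]
    have : 0 ≤ 2 / ε := by positivity
    calc _ = 2 * consistencyConst T (2 * ε) * Real.exp ((2 * (1 / ε) + 5) * T) := by field_simp
      _ ≤ _ := by unfold valueConst; linarith
  exact ⟨h1.1.trans h2, h1.2.trans h2⟩

lemma grid_mem_Ioc {N j : ℕ} (hj : j ≤ N) (hj2 : N < 2 * j) :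
    2 * (j : ℝ) / N - 1 ∈ Ioc (0 : ℝ) 1 := by
  have hN0 : (0 : ℝ) < N := by exact_mod_cast (by omega : 0 < N)
  refine ⟨?_, by linarith [(initial_mem hj).1]⟩
  rw [sub_pos, lt_div_iff₀ hN0, one_mul]
  exact_mod_cast hj2

lemma IsMasterSolution.eq_cost_grid {T : ℝ} (hT : 0 < T) {Z : ℝ → ℝ → ℝ} {U : ℝ → ℤˣ → ℝ → ℝ}
    (hZ : IsEntropySolution flux (fun m => 2 * m) T (fun _ => 0) Z) (hU : IsMasterSolution T Z U)
    {N j : ℕ} (hj : j ≤ N) (hj2 : N < 2 * j) {t : ℝ} (ht : t ∈ Icc 0 T) :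
    U t 1 (2 * ((j : ℝ) / N) - 1) = majorityCost (T - t) (2 * j / N - 1) ∧
    U t 1 (2 * (((N - j : ℕ) : ℝ) / N) - 1) = minorityCost (T - t) (2 * j / N - 1) := by
  have hN0 : (N : ℝ) ≠ 0 := by exact_mod_cast (by omega : N ≠ 0)
  have e1 : 2 * ((j : ℝ) / N) - 1 = 2 * j / N - 1 := by ring
  have e2 : 2 * (((N - j : ℕ) : ℝ) / N) - 1 = -(2 * j / N - 1) := by
    rw [Nat.cast_sub hj]
    field_simp
    ring
  rw [e1, e2]
  exact hU.eq_cost hT hZ ht (grid_mem_Ioc hj hj2)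

lemma valueEstimate_valueConst {T : ℝ} (hT : 0 < T) {Z : ℝ → ℝ → ℝ} {U : ℝ → ℤˣ → ℝ → ℝ}
    {V : ℕ → ℝ → ℝ → ℝ} (hZ : IsEntropySolution flux (fun m => 2 * m) T (fun _ => 0) Z)
    (hU : IsMasterSolution T Z U) (hV : ∀ N : ℕ, 1 ≤ N → IsNashValue T N (V N)) :
    ValueEstimate T U V (valueConst T) := by
  rintro ε hε N hN t ht _ ⟨⟨k, hk, rfl⟩, hkε⟩
  have hN0 : (0 : ℝ) < N := by exact_mod_cast hN
  have hv := (hV N hN).isGridValue hN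
  have ht' : T - t ∈ Icc 0 T := ⟨by linarith [ht.2], by linarith [ht.1]⟩
  have half_lt : ∀ j : ℕ, (1 / 2 + ε) * N ≤ j → N < 2 * j := fun j hj => by
    have h1 : (N : ℝ) < 2 * j := by
      have : 0 < ε * N := by positivity
      linarith
    exact_mod_cast h1
  have hcases : (1 / 2 + ε) * N ≤ k ∨ (1 / 2 + ε) * N ≤ ((N - k : ℕ) : ℝ) := by
    rw [mem_Ioo, not_and_or, not_lt, not_lt, div_le_iff₀ hN0, le_div_iff₀ hN0] at hkε
    rw [Nat.cast_sub hk]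
    rcases hkε with h | h
    · right; linarith
    · left; exact h
  rcases hcases with h | h
  · have h1 := (hv.abs_sub_cost_le hT hN hε hk h ht').1
    rw [(hU.eq_cost_grid hT hZ hk (half_lt k h) ht).1]
    simpa only [sub_sub_cancel] using h1
  · have h1 := (hv.abs_sub_cost_le hT hN hε (Nat.sub_le N k) h ht').2
    have h2 := (hU.eq_cost_grid hT hZ (Nat.sub_le N k) (half_lt _ h) ht).2
    have e : N - (N - k) = k := by omega
    rw [e] at h1 h2
    rw [h2]
    simpa only [sub_sub_cancel] using h1

/-! ### Blow-up of the constant beyond the shock time. -/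

/-- A bound of order `1 / N` up to the shock is incompatible with the damping at the centre. -/
lemma IsGridValue.false_of_uniform_bound {T : ℝ} (hT : 1 / 2 < T) {v : ℕ → ℕ → ℝ → ℝ}
    (hv : ∀ N : ℕ, 1 ≤ N → IsGridValue T N (v N)) {M : ℝ}
    (hM : ∀ N : ℕ, 1 ≤ N → ∀ j ≤ N, N < 2 * j → ∀ s ∈ Icc 0 T,
      |v N j s - majorityCost s (2 * j / N - 1)| ≤ M / N ∧
      |v N (N - j) s - minorityCost s (2 * j / N - 1)| ≤ M / N) : False := by
  set s₀ := (1 / 2 + T) / 2 with hs₀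
  have hs₀T : s₀ < T := by linarith
  have hs₀h : 1 / 2 < s₀ := by linarith
  have hM0 : 0 ≤ M := by
    have h1 := (hM 1 le_rfl 1 le_rfl (by norm_num) 0 ⟨le_rfl, by linarith⟩).1
    have := (abs_nonneg _).trans h1
    simpa using this
  -- For `s ≥ s₀`, `charPos_add_le` gives `0 < 1 - 2 s + 3 s x` at the foot `x`, so all feet are at
  -- least `c₀`, and `Z ≥ 2 c₁`. The constant `B` bounds `N` times the increment of the minority
  -- values at the centre: two errors `M / N`, and `4 / (c₀ N)` for the characteristic solution.
  set c₀ := (2 * s₀ - 1) / (3 * T) with hc₀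
  have hc₀p : 0 < c₀ := div_pos (by linarith) (by linarith)
  set c₁ := c₀ / (1 + T) with hc₁
  have hc₁p : 0 < c₁ := div_pos hc₀p (by linarith)
  set B := 2 * M + 4 / c₀ with hB
  have hB0 : 0 ≤ B := by positivity
  have hfoot : ∀ s ∈ Icc s₀ T, ∀ m ∈ Ioc (0 : ℝ) 1, c₀ ≤ charFoot s m := by
    intro s hs m hm
    have hx := charFoot_mem (t := s) hm
    have h1 := charPos_add_le (t := s) hx.1 hx.2 (by rw [charPos_charFoot hm]; exact hm.1)
    rw [charPos_charFoot hm] at h1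
    have hs0 : 0 < s := by linarith [hs.1]
    have h2 : 0 < s * charFoot s m := mul_pos hs0 hx.1
    rw [hc₀, div_le_iff₀ (by linarith)]
    have h3 : s * charFoot s m ≤ T * charFoot s m := mul_le_mul_of_nonneg_right hs.2 hx.1.le
    have h4 := hm.1
    linarith [hs.1]
  -- `k > 2` puts `k + 1` on the grid for `N = 2 k - 1`; the second bound lets the errors `M / N`
  -- consume at most half of `2 c₁`; the third makes the decrease over `[s₀, T]` exceed `2`.
  obtain ⟨k, hk⟩ := exists_nat_gt
    (max 2 (max (2 * M / c₁) ((2 + 2 * B * (T - s₀)) / (c₁ ^ 2 / 2 * (T - s₀)))))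
  obtain ⟨hk2, hk3⟩ := max_lt_iff.1 hk
  obtain ⟨hk3, hk4⟩ := max_lt_iff.1 hk3
  have hk2 : 2 < k := by exact_mod_cast hk2
  set N := 2 * k - 1 with hN
  have hN1 : 1 ≤ N := by omega
  have hkN : (k : ℝ) ≤ N := by exact_mod_cast (by omega : k ≤ N)
  have hN0 : (0 : ℝ) < N := by exact_mod_cast hN1
  have hNk : (N : ℝ) ≤ 2 * k := by exact_mod_cast (by omega : N ≤ 2 * k)
  have hbN := (hv N hN1).abs_le_one
  have hd : ∀ s ∈ Icc s₀ T, ∃ d ≤ 2 * B - c₁ ^ 2 / 2 * N,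
      HasDerivWithinAt (v N (N - k)) d (Icc 0 T) s := by
    intro s hs
    have hs' : s ∈ Icc 0 T := ⟨by linarith [hs.1], hs.2⟩
    refine ⟨_, ?_, (hv N hN1).deriv_center (by omega) (by omega) hs'⟩
    obtain ⟨h1, h2⟩ := hM N hN1 k (by omega) (by omega) s hs'
    have h3 := (hM N hN1 (k + 1) (by omega) (by omega) s hs').2
    have hm1 := grid_mem_Ioc (N := N) (j := k) (by omega) (by omega)
    have hm2 := grid_mem_Ioc (N := N) (j := k + 1) (by omega) (by omega)
    have hmm : 2 * ((k + 1 : ℕ) : ℝ) / N - 1 = 2 * (k : ℝ) / N - 1 + 2 / N := by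
      push_cast
      ring
    set m := 2 * (k : ℝ) / N - 1
    set n := 2 * ((k + 1 : ℕ) : ℝ) / N - 1
    have h2N : (0 : ℝ) < 2 / N := by positivity
    have hx := charFoot_mem (t := s) hm1
    have hxc := hfoot s hs m hm1
    have hmono := charFoot_mono hs'.1 hm1 hm2 (by linarith)
    have hlip := charFoot_lipschitz hs'.1 hm1 hm2 (by linarith)
    have hxy : charFoot s n - charFoot s m ≤ 4 / c₀ / N := by
      have h4 : c₀ / 2 ≤ m + s * charFoot s m := by
        have : 1 / 2 * c₀ ≤ s * charFoot s m :=
          mul_le_mul (by linarith [hs.1]) hxc hc₀p.le hs'.1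
        linarith [hm1.1]
      have h5 : c₀ / 2 * (charFoot s n - charFoot s m) ≤ 2 / N :=
        (mul_le_mul_of_nonneg_right h4 (by linarith)).trans (hlip.trans (by linarith))
      rw [div_div, le_div_iff₀ (by positivity)]
      rw [le_div_iff₀ hN0] at h5
      linarith
    have hW : v N (N - (k + 1)) s - v N (N - k) s ≤ B / N := by
      have h4 := (abs_le.1 h2).1
      have h5 := (abs_le.1 h3).2
      have h6 := (abs_le.1 (abs_charCost_sub_le hs'.1 hx.1.le hmono)).2
      have e : B / N = M / N + M / N + 4 / c₀ / N := by rw [hB]; ring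
      unfold minorityCost at h4 h5
      rw [e]
      linarith
    have hz : 2 * c₁ ≤ charVal s (charFoot s m) := by
      rw [charVal, hc₁, ← mul_div_assoc]
      have h4 : charFoot s m * s ≤ 1 * T := mul_le_mul hx.2 hs.2 hs'.1 zero_le_one
      have h5 : 0 ≤ charFoot s m * s := mul_nonneg hx.1.le hs'.1
      have h6 : 1 + charFoot s m * s ≤ 1 + T := by linarith
      have h7 := hx.1
      gcongr
    have hZ1 : c₁ ≤ v N (N - k) s - v N k s := by
      have h4 := (abs_le.1 h1).2
      have h5 := (abs_le.1 h2).1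
      have h6 : 2 * (M / N) ≤ c₁ := by
        rw [← mul_div_assoc, div_le_iff₀ hN0]
        rw [div_lt_iff₀ hc₁p] at hk3
        nlinarith
      unfold majorityCost at h4
      unfold minorityCost charCost at h5
      linarith
    have hZ2 : v N (N - k) s - v N k s ≤ 2 := by
      have h4 := abs_le.1 (hbN k (by omega) s hs')
      have h5 := abs_le.1 (hbN (N - k) (by omega) s hs')
      linarith
    set z := v N (N - k) s - v N k s
    have hNk' : ((N - k : ℕ) : ℝ) ≤ N := by exact_mod_cast Nat.sub_le N k
    have hz0 : 0 ≤ z := hc₁p.le.trans hZ1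
    have h4 : ((N - k : ℕ) : ℝ) * z * (v N (N - (k + 1)) s - v N (N - k) s) ≤ 2 * B := by
      calc _ ≤ ((N - k : ℕ) : ℝ) * z * (B / N) := by gcongr
        _ ≤ N * 2 * (B / N) := by gcongr
        _ = 2 * B := by field_simp
    have h5 : c₁ ^ 2 / 2 * N ≤ k * z ^ 2 := by
      calc c₁ ^ 2 / 2 * N ≤ c₁ ^ 2 / 2 * (2 * k) := by gcongr
        _ = k * c₁ ^ 2 := by ring
        _ ≤ _ := by gcongr
    have h6 : 0 ≤ z ^ 2 / 2 := by positivity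
    linarith
  choose! d hd1 hd2 using hd
  have hsub : Icc s₀ T ⊆ Icc 0 T := Icc_subset_Icc (by linarith) le_rfl
  have hda : ∀ s ∈ interior (Icc s₀ T), HasDerivAt (v N (N - k)) (d s) s := by
    intro s hs
    rw [interior_Icc] at hs
    exact (hd2 s (Ioo_subset_Icc_self hs)).hasDerivAt (Icc_mem_nhds (by linarith [hs.1]) hs.2)
  have hmv := Convex.image_sub_le_mul_sub_of_deriv_le (convex_Icc s₀ T)
    (fun s hs => ((hd2 s hs).mono hsub).continuousWithinAt)
    (fun s hs => (hda s hs).differentiableAt.differentiableWithinAt)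
    (fun s hs => by
      rw [(hda s hs).deriv]
      exact hd1 s (interior_subset hs))
    s₀ (left_mem_Icc.2 hs₀T.le) T (right_mem_Icc.2 hs₀T.le) hs₀T.le
  have h1 := abs_le.1 (hbN (N - k) (by omega) T (hsub (right_mem_Icc.2 hs₀T.le)))
  have h2 := abs_le.1 (hbN (N - k) (by omega) s₀ (hsub (left_mem_Icc.2 hs₀T.le)))
  have hTs : 0 < T - s₀ := by linarith
  rw [div_lt_iff₀ (by positivity)] at hk4
  have h3 : k * (c₁ ^ 2 / 2 * (T - s₀)) ≤ N * (c₁ ^ 2 / 2 * (T - s₀)) := by gcongr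
  linarith

lemma tendsto_atTop_of_valueEstimate {T : ℝ} (hT : 1 / 2 < T) {Z : ℝ → ℝ → ℝ}
    {U : ℝ → ℤˣ → ℝ → ℝ} {V : ℕ → ℝ → ℝ → ℝ}
    (hZ : IsEntropySolution flux (fun m => 2 * m) T (fun _ => 0) Z)
    (hU : IsMasterSolution T Z U) (hV : ∀ N : ℕ, 1 ≤ N → IsNashValue T N (V N)) {C : ℝ → ℝ}
    (hC : ValueEstimate T U V C) : Tendsto C (𝓝[>] 0) atTop := by
  have hT0 : 0 < T := by linarith
  by_contra hnot
  rw [tendsto_atTop] at hnot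
  push Not at hnot
  obtain ⟨M, hM⟩ := hnot
  -- Some `M` exceeds `C ε` for arbitrarily small `ε`. A grid point other than `1/2` is eventually
  -- outside the excluded interval, so the bound `M / N` holds there, uniformly up to the shock.
  have hbound : ∀ N : ℕ, 1 ≤ N → ∀ t ∈ Icc 0 T, ∀ k ≤ N, 2 * k ≠ N →
      |V N t (k / N) - U t 1 (2 * (k / N) - 1)| ≤ M / N := by
    intro N hN t ht k hk hkN
    have hN0 : (0 : ℝ) < N := by exact_mod_cast hN
    have hne : (k : ℝ) / N ≠ 1 / 2 := by
      intro h
      rw [div_eq_div_iff hN0.ne' two_ne_zero, one_mul] at h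
      refine hkN ?_
      have : (2 : ℝ) * k = N := by linarith
      exact_mod_cast this
    have hpos : 0 < |(k : ℝ) / N - 1 / 2| := abs_pos.2 (sub_ne_zero.2 hne)
    obtain ⟨ε, hε1, hε2⟩ := (hM.and_eventually (Ioo_mem_nhdsGT hpos)).exists
    refine (hC ε hε2.1 N hN t ht _ ⟨⟨k, hk, rfl⟩, ?_⟩).trans
      (div_le_div_of_nonneg_right hε1.le hN0.le)
    intro h
    have : |(k : ℝ) / N - 1 / 2| < ε := abs_lt.2 ⟨by linarith [h.1], by linarith [h.2]⟩
    exact this.not_ge hε2.2.le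
  refine IsGridValue.false_of_uniform_bound hT (v := fun N k s => V N (T - s) (k / N))
    (fun N hN => (hV N hN).isGridValue hN) (M := M) ?_
  intro N hN j hj hj2 s hs
  have hs' : T - s ∈ Icc 0 T := ⟨by linarith [hs.2], by linarith [hs.1]⟩
  obtain ⟨h1, h2⟩ := hU.eq_cost_grid hT0 hZ hj hj2 hs'
  rw [sub_sub_cancel] at h1 h2
  rw [← h1, ← h2]
  exact ⟨hbound N hN _ hs' j hj (by omega), hbound N hN _ hs' (N - j) (by omega) (by omega)⟩

end

end TwoStateMFG

theorem theorem3p5 (T : ℝ) (hT : 0 < T) :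
    -- the limit objects exist
    (∃ (Z : ℝ → ℝ → ℝ) (U : ℝ → ℤˣ → ℝ → ℝ),
      TwoStateMFG.IsEntropySolution TwoStateMFG.flux (fun m => 2 * m) T (fun _ => 0) Z ∧
      TwoStateMFG.IsMasterSolution T Z U) ∧
    -- the value functions of the games exist
    (∀ N : ℕ, 1 ≤ N → ∃ V : ℝ → ℝ → ℝ, TwoStateMFG.IsNashValue T N V) ∧
    -- convergence, with a constant that depends on `T` and `ε` only
    (∃ C : ℝ → ℝ, Tendsto C (𝓝[>] 0) atTop ∧
      ∀ (Z : ℝ → ℝ → ℝ) (U : ℝ → ℤˣ → ℝ → ℝ) (V : ℕ → ℝ → ℝ → ℝ),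
        TwoStateMFG.IsEntropySolution TwoStateMFG.flux (fun m => 2 * m) T (fun _ => 0) Z →
        TwoStateMFG.IsMasterSolution T Z U →
        (∀ N : ℕ, 1 ≤ N → TwoStateMFG.IsNashValue T N (V N)) →
        TwoStateMFG.ValueEstimate T U V C) ∧
    -- when the limit is discontinuous, every admissible constant blows up
    (1 / 2 < T →
      ∀ (Z : ℝ → ℝ → ℝ) (U : ℝ → ℤˣ → ℝ → ℝ) (V : ℕ → ℝ → ℝ → ℝ),
        TwoStateMFG.IsEntropySolution TwoStateMFG.flux (fun m => 2 * m) T (fun _ => 0) Z →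
        TwoStateMFG.IsMasterSolution T Z U →
        (∀ N : ℕ, 1 ≤ N → TwoStateMFG.IsNashValue T N (V N)) →
        ∀ C : ℝ → ℝ, TwoStateMFG.ValueEstimate T U V C → Tendsto C (𝓝[>] 0) atTop) := by
  refine ⟨⟨_, _, TwoStateMFG.isEntropySolution_entropySol hT,
      TwoStateMFG.isMasterSolution_masterSol hT⟩,
    fun N hN => TwoStateMFG.exists_isNashValue hT hN,
    ⟨TwoStateMFG.valueConst T, TwoStateMFG.tendsto_valueConst hT.le, fun Z U V hZ hU hV =>
      TwoStateMFG.valueEstimate_valueConst hT hZ hU hV⟩,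
    fun hT2 Z U V hZ hU hV C hC =>
      TwoStateMFG.tendsto_atTop_of_valueEstimate hT2 hZ hU hV hC⟩
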